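/- Let $A$ be a ring (associative, unital, not necessarily commutative) that is right coherent, i.e. every finitely generated right ideal of $A$ is finitely presented as a right $A$-module. All modules are right $A$-modules. Then the following are equivalent: (i) $A$ has finite weak global dimension, i.e. the supremum of the flat dimensions of all right $A$-modules is finite, where the flat dimension of $M$ is the least $n\ge 0$ for which there is an exact sequence $0\to F_n\to\cdots\to F_0\to M\to 0$ with all $F_i$ flat (and $\infty$ if there is none); (ii) there is an integer $n\ge 0$ such that every finitely presented right $A$-module has projective dimension at most $n$; (iii) $\mathsf{D}^{\mathrm{perf}}(A)$ has finite Rouquier dimension. Here $\mathsf{D}^{\mathrm{perf}}(A)$ is the full triangulated subcategory of the derived category of right $A$-modules on the objects isomorphic to bounded complexes of finitely generated projective right $A$-modules, and the Rouquier dimension of a triangulated category $\mathsf{T}$ is the least $d\ge 0$ such that some object $G$ satisfies $\mathsf{T}=\langle G\rangle_{d+1}$ (and $\infty$ if there is none), where $\langle G\rangle_1$ consists of the direct summands of finite direct sums of shifts of $G$, and $\langle G\rangle_{d+1}$ consists of the direct summands of objects $X$ in distinguished triangles $Y\to X\to Z\to \Sigma Y$ with $Y\in\langle G\rangle_1$ and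 $Z\in\langle G\rangle_d$. -/

import Mathlib

open CategoryTheory CategoryTheory.Limits CategoryTheory.Pretriangulated
open scoped TensorProduct ZeroObject

universe w u

/-! Right `A`-modules are modules over the opposite ring `Aᵐᵒᵖ`; left `A`-modules are modules
over `A`. -/

/-- A ring `A` is right coherent if every finitely generated right ideal of `A` is finitely
presented as a right `A`-module. -/
def IsRightCoherent (A : Type u) [Ring A] : Prop :=
  ∀ I : Submodule Aᵐᵒᵖ A, I.FG → Module.FinitePresentation Aᵐᵒᵖ I

noncomputable section

section BalancedTensor

variable (A : Type u) [Ring A] (M : Type u) [AddCommGroup M] [Module Aᵐᵒᵖ M]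

/-- The subgroup of `M ⊗[ℤ] N` generated by the elements `m a ⊗ x - m ⊗ a x`. -/
def balancedRelations (N : Type u) [AddCommGroup N] [Module A N] : AddSubgroup (M ⊗[ℤ] N) :=
  AddSubgroup.closure {t | ∃ (m : M) (a : A) (x : N),
    t = (MulOpposite.op a • m) ⊗ₜ[ℤ] x - m ⊗ₜ[ℤ] (a • x)}

/-- The tensor product over `A` of a right `A`-module `M` and a left `A`-module `N`. -/
abbrev BalancedTensor (N : Type u) [AddCommGroup N] [Module A N] : Type u :=
  (M ⊗[ℤ] N) ⧸ balancedRelations A M N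

variable {A} in
theorem balancedRelations_le_comap {N N' : Type u} [AddCommGroup N] [Module A N]
    [AddCommGroup N'] [Module A N'] (f : N →ₗ[A] N') :
    balancedRelations A M N ≤ (balancedRelations A M N').comap
      (f.toAddMonoidHom.toIntLinearMap.lTensor M).toAddMonoidHom := by
  refine (AddSubgroup.closure_le _).2 ?_
  rintro _ ⟨m, a, x, rfl⟩
  refine AddSubgroup.subset_closure ⟨m, a, f x, ?_⟩
  simp

variable {A} in
/-- The map `M ⊗_A N → M ⊗_A N'` induced by a map `f : N → N'` of left `A`-modules. -/
def BalancedTensor.map {N N' : Type u} [AddCommGroup N] [Module A N]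
    [AddCommGroup N'] [Module A N'] (f : N →ₗ[A] N') :
    BalancedTensor A M N →+ BalancedTensor A M N' :=
  QuotientAddGroup.map _ _ (f.toAddMonoidHom.toIntLinearMap.lTensor M).toAddMonoidHom
    (balancedRelations_le_comap M f)

/-- A right `A`-module `M` is flat if `M ⊗_A -` sends injective maps of left `A`-modules to
injective maps. -/
def IsFlatRightModule : Prop :=
  ∀ (N N' : Type u) [AddCommGroup N] [AddCommGroup N'] [Module A N] [Module A N']
    (f : N →ₗ[A] N'), Function.Injective f → Function.Injective (BalancedTensor.map M f)

end BalancedTensor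

section WeakDimension

variable (A : Type u) [Ring A]

/-- A right `A`-module `M` has flat dimension at most `n` if there is an exact sequence
`0 → F n → ⋯ → F 1 → F 0 → M → 0` of right `A`-modules with all `F i` flat. -/
def HasFlatDimensionLE (M : ModuleCat.{u} Aᵐᵒᵖ) (n : ℕ) : Prop :=
  ∃ (F : ℕ → ModuleCat.{u} Aᵐᵒᵖ) (d : ∀ i, F (i + 1) →ₗ[Aᵐᵒᵖ] F i) (ε : F 0 →ₗ[Aᵐᵒᵖ] M),
    (∀ i, IsFlatRightModule A (F i)) ∧ (∀ i, n < i → Subsingleton (F i)) ∧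
    Function.Surjective ε ∧ Function.Exact (d 0) ε ∧ ∀ i, Function.Exact (d (i + 1)) (d i)

/-- The flat dimension of a right `A`-module: the least length of a flat resolution, and `⊤` if
there is no flat resolution of finite length. -/
def flatDimension (M : ModuleCat.{u} Aᵐᵒᵖ) : ℕ∞ :=
  ⨅ (n : ℕ) (_ : HasFlatDimensionLE A M n), (n : ℕ∞)

/-- The weak global dimension of `A`: the supremum of the flat dimensions of all right
`A`-modules. -/
def weakGlobalDimension : ℕ∞ :=
  ⨆ M : ModuleCat.{u} Aᵐᵒᵖ, flatDimension A M

end WeakDimension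

/-- The Rouquier dimension of a triangulated category `T`: the least `d` such that there is an
object `G` from which every object of `T` can be reached by shifts, finite direct sums, direct
summands and at most `d` extensions (that is, `T = ⟨G⟩_{d+1}`), and `⊤` if there is no such `d`. -/
def rouquierDimension (T : Type*) [Category* T] [HasZeroObject T] [HasShift T ℤ]
    [Preadditive T] [∀ n : ℤ, (shiftFunctor T n).Additive] [Pretriangulated T] : ℕ∞ :=
  ⨅ (d : ℕ) (_ : ∃ G : T, (ObjectProperty.singleton G).triangEnvelopeIter d = ⊤), (d : ℕ∞)

section Perfect

variable {R : Type u} [Ring R]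

/-- A bounded cochain complex of finitely generated projective modules. -/
def IsStrictlyPerfect (K : CochainComplex (ModuleCat.{u} R) ℤ) : Prop :=
  (∃ a : ℤ, K.IsStrictlyGE a) ∧ (∃ b : ℤ, K.IsStrictlyLE b) ∧
    ∀ i : ℤ, Module.Finite R (K.X i) ∧ Module.Projective R (K.X i)

theorem IsStrictlyPerfect.shift {K : CochainComplex (ModuleCat.{u} R) ℤ}
    (hK : IsStrictlyPerfect K) (n : ℤ) : IsStrictlyPerfect (K⟦n⟧) := by
  obtain ⟨⟨a, ha⟩, ⟨b, hb⟩, h⟩ := hK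
  exact ⟨⟨a - n, K.isStrictlyGE_shift a n (a - n) (by lia)⟩,
    ⟨b - n, K.isStrictlyLE_shift b n (b - n) (by lia)⟩, fun i => h (i + n)⟩

theorem IsStrictlyPerfect.isKProjective {K : CochainComplex (ModuleCat.{u} R) ℤ}
    (hK : IsStrictlyPerfect K) : K.IsKProjective := by
  obtain ⟨-, ⟨b, hb⟩, h⟩ := hK
  have (i : ℤ) : Projective (K.X i) := by
    have := (h i).2
    exact (IsProjective.iff_projective (K.X i)).1 this
  exact CochainComplex.isKProjective_of_projective K b

theorem IsStrictlyPerfect.mappingCone {K L : CochainComplex (ModuleCat.{u} R) ℤ}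
    (hK : IsStrictlyPerfect K) (hL : IsStrictlyPerfect L) (f : K ⟶ L) :
    IsStrictlyPerfect (CochainComplex.mappingCone f) := by
  obtain ⟨⟨a, ha⟩, ⟨b, hb⟩, h⟩ := hK
  obtain ⟨⟨a', ha'⟩, ⟨b', hb'⟩, h'⟩ := hL
  have e (i : ℤ) : (CochainComplex.mappingCone f).X i ≅ K.X (i + 1) ⊞ L.X i :=
    HomologicalComplex.homotopyCofiber.XIsoBiprod f i (i + 1) rfl
  have hz (i : ℤ) (h₁ : IsZero (K.X (i + 1))) (h₂ : IsZero (L.X i)) :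
      IsZero ((CochainComplex.mappingCone f).X i) :=
    ((biprod_isZero_iff _ _).2 ⟨h₁, h₂⟩).of_iso (e i)
  refine ⟨⟨min (a - 1) a', ?_⟩, ⟨max b b', ?_⟩, fun i => ?_⟩
  · rw [CochainComplex.isStrictlyGE_iff]
    intro i hi
    exact hz i (K.isZero_of_isStrictlyGE a _ (by lia)) (L.isZero_of_isStrictlyGE a' _ (by lia))
  · rw [CochainComplex.isStrictlyLE_iff]
    intro i hi
    exact hz i (K.isZero_of_isStrictlyLE b _ (by lia)) (L.isZero_of_isStrictlyLE b' _ (by lia))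
  · have e' := (e i ≪≫ ModuleCat.biprodIsoProd _ _).toLinearEquiv.symm
    obtain ⟨_, _⟩ := h (i + 1)
    obtain ⟨_, _⟩ := h' i
    exact ⟨Module.Finite.equiv e', Module.Projective.of_equiv e'⟩

variable (R) [HasDerivedCategory.{w} (ModuleCat.{u} R)]

/-- Perfect complexes: the objects of the derived category of `R`-modules that are isomorphic to
a bounded complex of finitely generated projective modules. -/
def perfectComplexes : ObjectProperty (DerivedCategory.{w} (ModuleCat.{u} R)) :=
  fun X => ∃ K : CochainComplex (ModuleCat.{u} R) ℤ, IsStrictlyPerfect K ∧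
    Nonempty (X ≅ DerivedCategory.Q.obj K)

instance : (perfectComplexes.{w} R).IsClosedUnderIsomorphisms where
  of_iso := by
    rintro X Y e ⟨K, hK, ⟨e'⟩⟩
    exact ⟨K, hK, ⟨e.symm ≪≫ e'⟩⟩

instance : (perfectComplexes.{w} R).IsStableUnderShift ℤ where
  isStableUnderShiftBy n := ⟨by
    rintro X ⟨K, hK, ⟨e⟩⟩
    exact ⟨K⟦n⟧, hK.shift n, ⟨(shiftFunctor _ n).mapIso e ≪≫
      (DerivedCategory.Q.commShiftIso n).symm.app K⟩⟩⟩

instance : (perfectComplexes.{w} R).ContainsZero where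
  exists_zero := by
    have hZ : IsZero (0 : CochainComplex (ModuleCat.{u} R) ℤ) := isZero_zero _
    have hX (i : ℤ) : IsZero ((0 : CochainComplex (ModuleCat.{u} R) ℤ).X i) :=
      (HomologicalComplex.eval (ModuleCat.{u} R) (ComplexShape.up ℤ) i).map_isZero hZ
    refine ⟨DerivedCategory.Q.obj 0, DerivedCategory.Q.map_isZero hZ, 0,
      ⟨⟨0, ?_⟩, ⟨0, ?_⟩, fun i => ?_⟩, ⟨Iso.refl _⟩⟩
    · rw [CochainComplex.isStrictlyGE_iff]
      exact fun i _ => hX i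
    · rw [CochainComplex.isStrictlyLE_iff]
      exact fun i _ => hX i
    · have := ModuleCat.subsingleton_of_isZero (hX i)
      exact ⟨inferInstance, inferInstance⟩

instance : (perfectComplexes.{w} R).IsTriangulatedClosed₃ :=
  ObjectProperty.IsTriangulatedClosed₃.mk' (by
    rintro T hT ⟨K, hK, ⟨eK⟩⟩ ⟨L, hL, ⟨eL⟩⟩
    have := hK.isKProjective
    obtain ⟨g, hg⟩ := (CochainComplex.IsKProjective.Qh_map_bijective K
      ((HomotopyCategory.quotient _ _).obj L)).surjective
        ((DerivedCategory.quotientCompQhIso _).hom.app K ≫ eK.inv ≫ T.mor₁ ≫ eL.hom ≫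
          (DerivedCategory.quotientCompQhIso _).inv.app L)
    obtain ⟨f, rfl⟩ := (HomotopyCategory.quotient _ _).map_surjective g
    have hf : DerivedCategory.Q.map f = eK.inv ≫ T.mor₁ ≫ eL.hom := by
      rw [← cancel_epi ((DerivedCategory.quotientCompQhIso _).hom.app K),
        ← DerivedCategory.quotientCompQhIso_hom_naturality f, hg]
      simp
    have hc : T.mor₁ ≫ eL.hom = eK.hom ≫ DerivedCategory.Q.map f := by
      rw [hf, Iso.hom_inv_id_assoc]
    exact ⟨_, hK.mappingCone hL f, ⟨Triangle.π₃.mapIso (isoTriangleOfIso₁₂ T _ hT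
      (DerivedCategory.mappingCone_triangle_distinguished f) eK eL hc)⟩⟩)

instance : (perfectComplexes.{w} R).IsTriangulatedClosed₂ :=
  ObjectProperty.IsTriangulatedClosed₂.of_isTriangulatedClosed₃

instance : (perfectComplexes.{w} R).IsTriangulated where

/-- The triangulated category of perfect complexes, a full triangulated subcategory of the
derived category of all `R`-modules. -/
abbrev DPerf : Type _ := (perfectComplexes.{w} R).FullSubcategory

end Perfect

end

/-! Both (i) and (iii) are compared with (ii). Coherence makes kernels of maps between finitely
presented modules finitely presented (`IsPseudoCoherent.finitePresentation_ker`), so syzygies and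
the cohomology of perfect complexes remain finitely presented.

(i) and (ii). A module is flat exactly when every map to it from a finitely presented module factors
through a finite free one (`isFlatRightModule_iff_factorsThroughFree`). Hence finitely presented
flat modules are projective, and taking syzygies gives (i) ⇒ (ii). Conversely, let `K` be the kernel
of the free module on the set `M` onto `M`. A finitely generated `S ≤ K` lies in a finite free `F`
with `F / S` finitely presented, so its projective dimension is bounded. This local bound drops by
one at each further syzygy (`LocallyProjectiveDimensionLT.ker`), and local projectivity gives
flatness.

(ii) ⇒ (iii). A sum `B` of shifted finitely generated projectives maps to a perfect complex `X`
surjectively on cohomology. The cohomology of the cone consists of the kernels, whose projective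
dimension is one less. After `n` steps the cohomology is projective and `B → X` can be chosen to be
an isomorphism, so `A` generates.

(iii) ⇒ (ii). This is a form of the ghost lemma. For a perfect complex of amplitude less than `c`, a
map to a module in degree `p` followed by a map to a module in degree `q ≤ p - c` vanishes. Such
constants add up in triangles, because Ext classes factor through intermediate degrees
(`exists_factorization`); so one constant serves all perfect complexes. A finitely presented module
agrees with a perfect complex down to any given degree, so its high Ext groups vanish. -/

/-! ### Coherence and finitely presented modules -/

section Coherence

/-- A module is pseudo-coherent if all its finitely generated submodules are finitely presented. -/
def IsPseudoCoherent (R : Type*) [Ring R] (M : Type*) [AddCommGroup M] [Module R M] : Prop :=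
  ∀ S : Submodule R M, S.FG → Module.FinitePresentation R S

variable {R : Type*} [Ring R] {M N : Type*} [AddCommGroup M] [Module R M]
  [AddCommGroup N] [Module R N]

theorem IsPseudoCoherent.of_injective (hN : IsPseudoCoherent R N) (f : M →ₗ[R] N)
    (hf : Function.Injective f) : IsPseudoCoherent R M := fun S hS => by
  have := hN (S.map f) (hS.map f)
  exact .of_equiv (Submodule.equivMapOfInjective f hf S).symm

/-- `S` is an extension of its image in `N` by `S ∩ ker f`. The image is finitely presented, so the
intersection is finitely generated, hence finitely presented too. -/
theorem IsPseudoCoherent.of_ker (f : M →ₗ[R] N) (hN : IsPseudoCoherent R N)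
    (hf : IsPseudoCoherent R (LinearMap.ker f)) : IsPseudoCoherent R M := fun S hS => by
  have : Module.Finite R S := Module.Finite.iff_fg.2 hS
  let g : S →ₗ[R] N := f ∘ₗ S.subtype
  have hg : (LinearMap.range g).FG := by
    rw [LinearMap.range_eq_map]
    exact (Module.Finite.fg_top (R := R) (M := S)).map g
  have := hN _ hg
  have : Module.Finite R (LinearMap.ker g.rangeRestrict) := Module.Finite.iff_fg.2
    (Module.FinitePresentation.fg_ker g.rangeRestrict g.surjective_rangeRestrict)
  let h : LinearMap.ker g.rangeRestrict →ₗ[R] LinearMap.ker f :=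
    (S.subtype ∘ₗ (LinearMap.ker g.rangeRestrict).subtype).codRestrict _ (fun x => by
      have := congrArg Subtype.val (LinearMap.mem_ker.1 x.2)
      exact this)
  have hh : Function.Injective h := fun x y hxy => by
    have := congrArg Subtype.val hxy
    exact Subtype.ext (Subtype.ext this)
  have := hf.of_injective h hh ⊤ Module.Finite.fg_top
  have : Module.FinitePresentation R (LinearMap.ker g.rangeRestrict) :=
    .of_equiv Submodule.topEquiv
  exact Module.finitePresentation_of_ker g.rangeRestrict g.surjective_rangeRestrict

theorem IsPseudoCoherent.prod (hM : IsPseudoCoherent R M) (hN : IsPseudoCoherent R N) :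
    IsPseudoCoherent R (M × N) := by
  refine .of_ker (LinearMap.snd R M N) hN
    (hM.of_injective (LinearMap.fst R M N ∘ₗ Submodule.subtype _) ?_)
  rintro ⟨⟨a, b⟩, h⟩ ⟨⟨a', b'⟩, h'⟩ hab
  obtain rfl : b = 0 := h
  obtain rfl : b' = 0 := h'
  simp_all

theorem IsPseudoCoherent.pi (hR : IsPseudoCoherent R R) (ι : Type*) [Finite ι] :
    IsPseudoCoherent R (ι → R) :=
  Module.pi_induction' (motive := fun N _ _ => IsPseudoCoherent R N)
    (motive' := fun N _ _ => IsPseudoCoherent R N) R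
    (fun e h => h.of_injective _ e.symm.injective) (fun e h => h.of_injective _ e.symm.injective)
    (fun _ _ => inferInstance)
    (fun h h' => h.prod h') _ (fun _ => hR)

/-- The preimage of `S` under a presentation `R^n → M` is finitely generated, hence finitely
presented inside `R^n`, and `S` is its quotient by the finitely generated kernel `K`. -/
theorem IsPseudoCoherent.of_finitePresentation (hR : IsPseudoCoherent R R)
    [Module.FinitePresentation R M] : IsPseudoCoherent R M := fun S hS => by
  obtain ⟨n, K, e, hK⟩ := Module.FinitePresentation.exists_fin R M
  let π : (Fin n → R) →ₗ[R] M := e.symm.toLinearMap ∘ₗ K.mkQ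
  have hπ : Function.Surjective π := e.symm.surjective.comp K.mkQ_surjective
  have hker : LinearMap.ker π = K := by simp [π, LinearMap.ker_comp]
  have hT : (S.comap π).FG := by
    refine Submodule.fg_of_fg_map_of_fg_inf_ker π ?_ ?_
    · rwa [Submodule.map_comap_eq_of_surjective hπ]
    · rwa [inf_eq_right.2 (LinearMap.ker_le_comap π), hker]
  have := hR.pi (Fin n) _ hT
  have := (hR.pi (Fin n)).of_injective (S.comap π).subtype Subtype.val_injective
  let ρ : S.comap π →ₗ[R] S := π.restrict (fun _ h => h)
  have hρ : Function.Surjective ρ := fun ⟨s, hs⟩ => by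
    obtain ⟨x, rfl⟩ := hπ s
    exact ⟨⟨x, hs⟩, rfl⟩
  refine Module.finitePresentation_of_surjective ρ hρ ?_
  have : LinearMap.ker ρ = (LinearMap.ker π).comap (S.comap π).subtype := by
    ext x
    simp [ρ, LinearMap.restrict_apply, Subtype.ext_iff]
  rw [this, ← Submodule.fg_map_iff (S.comap π).subtype Subtype.val_injective,
    Submodule.map_comap_subtype, inf_eq_right.2 (LinearMap.ker_le_comap π), hker]
  exact hK

theorem IsPseudoCoherent.finitePresentation_ker (hR : IsPseudoCoherent R R)
    [Module.FinitePresentation R M] [Module.FinitePresentation R N] (f : M →ₗ[R] N) :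
    Module.FinitePresentation R (LinearMap.ker f) := by
  have : Module.FinitePresentation R (LinearMap.range f) :=
    hR.of_finitePresentation _ (by
      rw [LinearMap.range_eq_map]
      exact (Module.Finite.fg_top (R := R) (M := M)).map f)
  have h := Module.FinitePresentation.fg_ker f.rangeRestrict f.surjective_rangeRestrict
  rw [LinearMap.ker_rangeRestrict] at h
  exact hR.of_finitePresentation _ h

theorem IsRightCoherent.isPseudoCoherent {A : Type u} [Ring A] (hA : IsRightCoherent A) :
    IsPseudoCoherent Aᵐᵒᵖ Aᵐᵒᵖ :=
  IsPseudoCoherent.of_injective (N := A) hA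
    { toFun := MulOpposite.unop, map_add' := fun _ _ => rfl, map_smul' := fun _ _ => rfl }
    MulOpposite.unop_injective

end Coherence

noncomputable section

/-! ### Flatness and the equational criterion -/

section TrivialRelations

open MulOpposite

variable {A : Type u} [Ring A] {M : Type u} [AddCommGroup M] [Module Aᵐᵒᵖ M]
  {N : Type u} [AddCommGroup N] [Module A N]

namespace BalancedTensor

variable (A) in
/-- The pure tensor `m ⊗ x` in the tensor product of a right module and a left module. -/
def tmul (m : M) (x : N) : BalancedTensor A M N := QuotientAddGroup.mk (m ⊗ₜ[ℤ] x)

theorem tmul_add (m : M) (x y : N) : tmul A m (x + y) = tmul A m x + tmul A m y := by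
  simp [tmul, TensorProduct.tmul_add]

theorem tmul_zero (m : M) : tmul A m (0 : N) = 0 := by
  simp [tmul]

theorem add_tmul (m m' : M) (x : N) : tmul A (m + m') x = tmul A m x + tmul A m' x := by
  simp [tmul, TensorProduct.add_tmul]

theorem zero_tmul (x : N) : tmul A (0 : M) x = 0 := by
  simp [tmul]

theorem smul_tmul (m : M) (a : A) (x : N) : tmul A (op a • m) x = tmul A m (a • x) := by
  rw [tmul, tmul, ← sub_eq_zero, ← QuotientAddGroup.mk_sub, QuotientAddGroup.eq_zero_iff]
  exact AddSubgroup.subset_closure ⟨m, a, x, rfl⟩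

theorem sum_tmul {ι : Type*} (s : Finset ι) (m : ι → M) (x : N) :
    tmul A (∑ i ∈ s, m i) x = ∑ i ∈ s, tmul A (m i) x :=
  map_sum (⟨⟨fun m => tmul A m x, zero_tmul x⟩, fun m m' => add_tmul m m' x⟩ :
    M →+ BalancedTensor A M N) m s

theorem tmul_sum {ι : Type*} (s : Finset ι) (m : M) (x : ι → N) :
    tmul A m (∑ i ∈ s, x i) = ∑ i ∈ s, tmul A m (x i) :=
  map_sum (⟨⟨fun x => tmul A m x, tmul_zero m⟩, fun x y => tmul_add m x y⟩ :
    N →+ BalancedTensor A M N) x s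

theorem map_tmul {N' : Type u} [AddCommGroup N'] [Module A N'] (f : N →ₗ[A] N') (m : M) (x : N) :
    map M f (tmul A m x) = tmul A m (f x) := rfl

theorem exists_eq_sum_tmul (t : BalancedTensor A M N) :
    ∃ (ι : Type) (_ : Fintype ι) (x : ι → M) (z : ι → N), t = ∑ i, tmul A (x i) (z i) := by
  obtain ⟨t, rfl⟩ := QuotientAddGroup.mk_surjective t
  induction t using TensorProduct.induction_on with
  | zero => exact ⟨Empty, inferInstance, Empty.elim, Empty.elim, by simp⟩
  | tmul m x => exact ⟨Unit, inferInstance, fun _ => m, fun _ => x, by simp [tmul]⟩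
  | add t t' h h' =>
    obtain ⟨ι, _, x, z, h⟩ := h
    obtain ⟨ι', _, x', z', h'⟩ := h'
    refine ⟨ι ⊕ ι', inferInstance, Sum.elim x x', Sum.elim z z', ?_⟩
    rw [QuotientAddGroup.mk_add, h, h', Fintype.sum_sum_type]
    rfl

/-- The element `∑ y, (m r_y) y` of `⨁_N M` attached to `m` in a right module `M` and a
finitely supported function `r` on `N`. -/
def spread (m : M) (r : N →₀ A) : N →₀ M := r.mapRange (fun a => op a • m) (by simp)

omit [AddCommGroup N] [Module A N] in
theorem spread_apply (m : M) (r : N →₀ A) (y : N) : spread m r y = op (r y) • m := rfl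

omit [AddCommGroup N] [Module A N] in
theorem spread_neg (m : M) (r : N →₀ A) : spread (-m) r = - spread m r := by
  ext y
  simp [spread_apply]

variable (A M N) in
/-- The subgroup of `⨁_N M` generated by the relations of the left module `N`. -/
def relationSubgroup : AddSubgroup (N →₀ M) where
  carrier := {w | ∃ (κ : Type) (_ : Fintype κ) (m : κ → M) (r : κ → N →₀ A),
    (∀ k, Finsupp.linearCombination A id (r k) = 0) ∧ w = ∑ k, spread (m k) (r k)}
  zero_mem' := ⟨Empty, inferInstance, Empty.elim, Empty.elim, fun k => k.elim, by simp⟩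
  add_mem' := by
    rintro _ _ ⟨κ, _, m, r, h, rfl⟩ ⟨κ', _, m', r', h', rfl⟩
    refine ⟨κ ⊕ κ', inferInstance, Sum.elim m m', Sum.elim r r', ?_, ?_⟩
    · rintro (k | k)
      exacts [h k, h' k]
    · rw [Fintype.sum_sum_type]
      rfl
  neg_mem' := by
    rintro _ ⟨κ, _, m, r, h, rfl⟩
    exact ⟨κ, inferInstance, fun k => -m k, r, h, by simp [spread_neg]⟩

theorem spread_mem_relationSubgroup (m : M) (r : N →₀ A)
    (hr : Finsupp.linearCombination A id r = 0) : spread m r ∈ relationSubgroup A M N :=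
  ⟨Unit, inferInstance, fun _ => m, fun _ => r, fun _ => hr, by simp⟩

variable (A M N) in
/-- The bilinear map sending `(m, x)` to the class of the element of `⨁_N M` which is `m` at `x`. -/
def toQuotientBilin : M →+ N →+ (N →₀ M) ⧸ relationSubgroup A M N :=
  AddMonoidHom.mk' (fun m => AddMonoidHom.mk' (fun x => (QuotientAddGroup.mk (Finsupp.single x m)))
    (fun x y => by
      rw [← QuotientAddGroup.mk_add, ← sub_eq_zero, ← QuotientAddGroup.mk_sub,
        QuotientAddGroup.eq_zero_iff]
      convert spread_mem_relationSubgroup (A := A) m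
        (Finsupp.single (x + y) 1 - (Finsupp.single x 1 + Finsupp.single y 1)) (by simp) using 1
      classical
      ext z
      simp only [spread_apply, Finsupp.sub_apply, Finsupp.add_apply, Finsupp.single_apply,
        MulOpposite.op_sub, MulOpposite.op_add, sub_smul, add_smul]
      split_ifs <;> simp))
    (fun m m' => by
      ext x
      simp)

variable (A M N) in
/-- The map from the tensor product to the quotient of `⨁_N M` by the relations of `N`. -/
def toQuotient : BalancedTensor A M N →+ (N →₀ M) ⧸ relationSubgroup A M N :=
  QuotientAddGroup.lift _ (TensorProduct.liftAddHom (toQuotientBilin A M N) (by simp)) (by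
    refine (AddSubgroup.closure_le _).2 ?_
    rintro _ ⟨m, a, x, rfl⟩
    change _ = _
    rw [map_sub, TensorProduct.liftAddHom_tmul, TensorProduct.liftAddHom_tmul]
    change QuotientAddGroup.mk _ - QuotientAddGroup.mk _ = _
    rw [← QuotientAddGroup.mk_sub, QuotientAddGroup.eq_zero_iff]
    convert spread_mem_relationSubgroup (A := A) m
      (Finsupp.single x a - Finsupp.single (a • x) 1) (by simp) using 1
    classical
    ext z
    simp only [spread_apply, Finsupp.sub_apply, Finsupp.single_apply, MulOpposite.op_sub, sub_smul]
    split_ifs <;> simp)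

theorem toQuotient_tmul (m : M) (x : N) :
    toQuotient A M N (tmul A m x) = QuotientAddGroup.mk (Finsupp.single x m) := rfl

/-- A vanishing sum of pure tensors becomes trivial after adding finitely many terms `m ⊗ 0`. -/
theorem exists_relations_of_sum_eq_zero {ι : Type} [Fintype ι] (x : ι → M) (z : ι → N)
    (h : ∑ i, tmul A (x i) (z i) = 0) :
    ∃ (κ : Type) (_ : Fintype κ) (m : κ → M) (Y : Finset N) (b : ι ⊕ κ → Y → A),
      (∀ i, z i = ∑ y, b (.inl i) y • y.1) ∧ (∀ k, ∑ y, b (.inr k) y • y.1 = 0) ∧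
      ∀ y, ∑ i, op (b i y) • Sum.elim x m i = 0 := by
  classical
  have h' := congrArg (toQuotient A M N) h
  simp only [map_sum, map_zero, toQuotient_tmul] at h'
  rw [← QuotientAddGroup.mk_sum, QuotientAddGroup.eq_zero_iff] at h'
  obtain ⟨κ, _, m, r, hr, hw⟩ := h'
  -- `Y` contains every element of `N` that occurs, so the identity in `N →₀ M` can be read
  -- coordinatewise on it. The sign given to `r` below moves the relations to the other side.
  let Y : Finset N := Finset.univ.image z ∪ Finset.univ.biUnion (fun k => (r k).support)
  refine ⟨κ, inferInstance, m, Y,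
    Sum.elim (fun i y => if z i = y then 1 else 0) (fun k y => - r k y), fun i => ?_, fun k => ?_,
    fun y => ?_⟩
  · have hi : z i ∈ Y := by simp [Y]
    rw [Finset.sum_eq_single ⟨z i, hi⟩]
    · simp
    · rintro ⟨y, hy⟩ - hne
      have : z i ≠ y := fun e => hne (by simp [e])
      simp [this]
    · simp
  · have := hr k
    rw [Finsupp.linearCombination_apply, Finsupp.sum_of_support_subset (s := Y) _ (by
      intro y hy
      simp only [Y, Finset.mem_union, Finset.mem_biUnion]
      exact Or.inr ⟨k, Finset.mem_univ _, hy⟩) _ (by simp)] at this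
    simp only [Sum.elim_inr, neg_smul, Finset.sum_neg_distrib, neg_eq_zero]
    rw [← this]
    exact Finset.sum_coe_sort Y (fun y => r k y • y)
  · have := DFunLike.congr_fun hw y.1
    simp only [Finsupp.coe_finsetSum, Finset.sum_apply, spread_apply] at this
    rw [Fintype.sum_sum_type]
    simp only [Sum.elim_inl, Sum.elim_inr, MulOpposite.op_neg, neg_smul, Finset.sum_neg_distrib, ← this]
    rw [← sub_eq_add_neg, sub_eq_zero]
    refine Finset.sum_congr rfl fun i _ => ?_
    rw [Finsupp.single_apply]
    split_ifs <;> simp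

end BalancedTensor

variable (A M) in
/-- All finite systems of linear relations in the right module `M` are trivial. -/
def RelationsTrivial : Prop :=
  ∀ (ι : Type) (σ : Type u) [Fintype ι] [Fintype σ] (x : ι → M) (a : ι → σ → A),
    (∀ s, ∑ i, op (a i s) • x i = 0) →
    ∃ (l : Type) (_ : Fintype l) (m : l → M) (c : l → ι → A),
      (∀ i, x i = ∑ j, op (c j i) • m j) ∧ ∀ j s, ∑ i, c j i * a i s = 0

-- The relations killing `∑ x i ⊗ f (z i)` involve elements of `N'`. Trivialising them in `M` leaves
-- only the relations `∑ c j i • f (z' i) = 0`, which descend to `N` because `f` is injective.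
open BalancedTensor in
theorem RelationsTrivial.isFlatRightModule (h : RelationsTrivial A M) :
    IsFlatRightModule A M := by
  intro N N' _ _ _ _ f hf
  rw [injective_iff_map_eq_zero]
  intro t ht
  obtain ⟨ι, _, x, z, rfl⟩ := exists_eq_sum_tmul t
  simp only [map_sum, map_tmul] at ht
  obtain ⟨κ, _, m, Y, b, hz, hk, hb⟩ := exists_relations_of_sum_eq_zero x (fun i => f (z i)) ht
  obtain ⟨l, _, n, c, hc, hcb⟩ := h _ _ _ b hb
  let z' : ι ⊕ κ → N := Sum.elim z 0
  have hz' (i : ι ⊕ κ) : f (z' i) = ∑ y, b i y • y.1 := by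
    cases i with
    | inl i => exact hz i
    | inr k => rw [hk]; simp [z']
  have h0 (j : l) : ∑ i, c j i • z' i = 0 := by
    apply hf
    simp only [map_sum, map_smul, hz', map_zero, Finset.smul_sum]
    rw [Finset.sum_comm]
    simp only [smul_smul, ← Finset.sum_smul, hcb, zero_smul, Finset.sum_const_zero]
  have : ∑ i, tmul A (x i) (z i) = ∑ i, tmul A (Sum.elim x m i) (z' i) := by
    simp [Fintype.sum_sum_type, z', tmul_zero]
  rw [this]
  simp only [hc, sum_tmul, smul_tmul]
  rw [Finset.sum_comm]
  simp only [← tmul_sum, h0, tmul_zero, Finset.sum_const_zero]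

-- The hypothesis on `x` says that `∑ x i ⊗ a i` dies in `M ⊗ A^σ`. By flatness it already dies in
-- `M ⊗ I`, where `I` is spanned by the rows `a i`.
open BalancedTensor in
theorem IsFlatRightModule.relationsTrivial (h : IsFlatRightModule A M) :
    RelationsTrivial A M := by
  classical
  intro ι σ _ _ x a hx
  let I : Submodule A (σ → A) := Submodule.span A (Set.range a)
  let z (i : ι) : I := ⟨a i, Submodule.subset_span ⟨i, rfl⟩⟩
  have h0 : ∑ i, tmul A (x i) (z i) = 0 := by
    apply h I (σ → A) I.subtype Subtype.val_injective
    simp only [map_sum, map_tmul, map_zero]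
    have (i : ι) : I.subtype (z i) = ∑ s, a i s • (Pi.single s 1 : σ → A) := by
      ext s
      simp [z, Finset.sum_apply, Pi.single_apply]
    simp only [this, tmul_sum, ← smul_tmul]
    rw [Finset.sum_comm]
    simp only [← sum_tmul, hx, zero_tmul, Finset.sum_const_zero]
  obtain ⟨κ, _, m, Y, b, hz, hk, hb⟩ := exists_relations_of_sum_eq_zero x z h0
  have hY (y : Y) : ∃ c : ι → A, y.1.1 = ∑ i, c i • a i := by
    obtain ⟨c, hc⟩ := (Submodule.mem_span_range_iff_exists_fun A).1 y.1.2
    exact ⟨c, hc.symm⟩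
  choose c hc using hY
  have hbc (i : ι ⊕ κ) : ∑ i', (∑ y, b i y * c y i') • a i' = (∑ y, b i y • y.1 : I).1 := by
    simp only [Finset.sum_smul, mul_smul]
    rw [Finset.sum_comm]
    simp only [← Finset.smul_sum, ← hc]
    simp
  -- The trivialising matrix is `δ - b c`. The term `b c` contributes nothing to `x` by `hb`, and
  -- applied to the rows `a` it gives `z` on `ι` and `0` on `κ`, which cancels `δ`.
  refine ⟨ι ⊕ κ, inferInstance, Sum.elim x m,
    fun j i => Sum.elim (fun i' => if i' = i then (1 : A) else 0) 0 j - ∑ y, b j y * c y i,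
    fun i => ?_, fun j s => ?_⟩
  · simp only [MulOpposite.op_sub, sub_smul, Finset.sum_sub_distrib, Finset.op_sum, MulOpposite.op_mul,
      Finset.sum_smul, mul_smul]
    rw [Finset.sum_comm (f := fun j y => op (c y i) • op (b j y) • (Sum.elim x m j : M))]
    simp only [← Finset.smul_sum, hb, smul_zero, Finset.sum_const_zero, sub_zero]
    rw [Fintype.sum_sum_type]
    simp [apply_ite op, ite_smul]
  · have : ∑ i, (Sum.elim (fun i' => if i' = i then (1 : A) else 0) 0 j - ∑ y, b j y * c y i) • a i
        = 0 := by
      simp only [sub_smul, Finset.sum_sub_distrib, hbc]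
      cases j with
      | inl i' => rw [← hz]; simp [z, ite_smul]
      | inr k => rw [hk]; simp
    have := congrFun this s
    simpa [Finset.sum_apply] using this

end TrivialRelations

/-! ### Flatness as factorization through finite free modules -/

section FactorsThroughFree

variable {R : Type u} [Ring R]

variable (R) in
/-- Every map from a finitely presented module to `M` factors through a finite free module. -/
def FactorsThroughFree (M : Type u) [AddCommGroup M] [Module R M] : Prop :=
  ∀ (X : Type u) [AddCommGroup X] [Module R X] [Module.FinitePresentation R X] (φ : X →ₗ[R] M),
    ∃ (l : Type) (_ : Fintype l) (g : X →ₗ[R] (l → R)) (ψ : (l → R) →ₗ[R] M), φ = ψ ∘ₗ g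

variable {A : Type u} [Ring A] {M : Type u} [AddCommGroup M] [Module Aᵐᵒᵖ M]

open MulOpposite

/-- A map out of a finitely presented module is a finite system of relations among the images of the
generators; trivialising the system is factoring the map. -/
theorem RelationsTrivial.factorsThroughFree (h : RelationsTrivial A M) :
    FactorsThroughFree Aᵐᵒᵖ M := by
  classical
  intro X _ _ _ φ
  obtain ⟨n, k, f, g, hf, hfg⟩ := Module.FinitePresentation.exists_fin' Aᵐᵒᵖ X
  let B := Pi.basisFun Aᵐᵒᵖ (Fin n)
  -- `ULift` appears because the equations in `RelationsTrivial` are indexed by types in `Type u`,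
  -- so as to allow finite subsets of modules.
  obtain ⟨l, _, m, c, hm, hc⟩ := h (Fin n) (ULift.{u} (Fin k)) (fun i => φ (f (Pi.single i 1)))
    (fun i s => unop (g (Pi.single s.down 1) i)) (fun s => by
      simp only [op_unop, ← map_smul, ← map_sum, ← Pi.single_smul', smul_eq_mul, mul_one]
      rw [Finset.univ_sum_single, hfg.apply_apply_eq_zero, map_zero])
  let q : (Fin n → Aᵐᵒᵖ) →ₗ[Aᵐᵒᵖ] (l → Aᵐᵒᵖ) := B.constr ℕ (fun i j => op (c j i))
  let ψ : (l → Aᵐᵒᵖ) →ₗ[Aᵐᵒᵖ] M := (Pi.basisFun Aᵐᵒᵖ l).constr ℕ m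
  have hq : LinearMap.ker f ≤ LinearMap.ker q := by
    rw [LinearMap.exact_iff.1 hfg, LinearMap.range_le_ker_iff]
    refine (Pi.basisFun Aᵐᵒᵖ (Fin k)).ext fun s => ?_
    ext j
    have := congrArg op (hc j ⟨s⟩)
    simpa [q, B, Module.Basis.constr_apply_fintype, Finset.sum_apply, Finset.op_sum] using this
  refine ⟨l, inferInstance, (LinearMap.ker f).liftQ q hq ∘ₗ
    (f.quotKerEquivOfSurjective hf).symm.toLinearMap, ψ, ?_⟩
  rw [← LinearMap.cancel_right hf]
  refine B.ext fun i => ?_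
  have : (f.quotKerEquivOfSurjective hf).symm (f (B i)) = Submodule.Quotient.mk (B i) := by
    rw [LinearEquiv.symm_apply_eq]
    rfl
  simp only [LinearMap.comp_apply, LinearEquiv.coe_coe, this, Submodule.liftQ_apply]
  simp only [q, Module.Basis.constr_basis]
  simp [ψ, B, Module.Basis.constr_apply_fintype, hm]

/-- The system is a map out of the cokernel of its matrix; the coefficients are read off a
factorization of that map. -/
theorem FactorsThroughFree.relationsTrivial (h : FactorsThroughFree Aᵐᵒᵖ M) :
    RelationsTrivial A M := by
  classical
  intro ι σ _ _ x a hx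
  let B := Pi.basisFun Aᵐᵒᵖ ι
  let K : Submodule Aᵐᵒᵖ (ι → Aᵐᵒᵖ) := Submodule.span _ (Set.range fun s i => op (a i s))
  have : Module.FinitePresentation Aᵐᵒᵖ ((ι → Aᵐᵒᵖ) ⧸ K) :=
    Module.finitePresentation_of_surjective K.mkQ K.mkQ_surjective (by
      rw [Submodule.ker_mkQ]
      exact Submodule.fg_span (Set.finite_range _))
  let φ : ((ι → Aᵐᵒᵖ) ⧸ K) →ₗ[Aᵐᵒᵖ] M := K.liftQ (B.constr ℕ x) (by
    rw [Submodule.span_le]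
    rintro _ ⟨s, rfl⟩
    simpa [B, Module.Basis.constr_apply_fintype] using hx s)
  obtain ⟨l, _, g, ψ, hψ⟩ := h _ φ
  refine ⟨l, inferInstance, fun j => ψ (Pi.single j 1), fun j i => unop (g (K.mkQ (B i)) j),
    fun i => ?_, fun j s => ?_⟩
  · have h1 : x i = φ (K.mkQ (B i)) := by
      simp only [φ, Submodule.mkQ_apply, Submodule.liftQ_apply, Module.Basis.constr_basis]
    rw [h1, hψ, LinearMap.comp_apply]
    conv_lhs => rw [← Finset.univ_sum_single (g (K.mkQ (B i))), map_sum]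
    refine Finset.sum_congr rfl fun j _ => ?_
    rw [op_unop, ← map_smul, ← Pi.single_smul', smul_eq_mul, mul_one]
  · have h1 : K.mkQ (fun i => op (a i s)) = 0 := by
      rw [Submodule.mkQ_apply, Submodule.Quotient.mk_eq_zero]
      exact Submodule.subset_span ⟨s, rfl⟩
    have h2 : (fun i => op (a i s)) = ∑ i, op (a i s) • B i := by
      ext i
      simp [B, Finset.sum_apply, Pi.single_apply]
    apply op_injective
    have := congrFun (congrArg g h1) j
    rw [h2] at this
    simpa [Finset.sum_apply, Finset.op_sum] using this

theorem isFlatRightModule_iff_factorsThroughFree :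
    IsFlatRightModule A M ↔ FactorsThroughFree Aᵐᵒᵖ M :=
  ⟨fun h => h.relationsTrivial.factorsThroughFree, fun h => h.relationsTrivial.isFlatRightModule⟩

end FactorsThroughFree

end

/-! ### Flat dimension by syzygies -/

section FlatDimension

variable {R : Type u} [Ring R] {M N : Type u} [AddCommGroup M] [Module R M]
  [AddCommGroup N] [Module R N]

theorem FactorsThroughFree.of_equiv (h : FactorsThroughFree R M) (e : M ≃ₗ[R] N) :
    FactorsThroughFree R N := fun X _ _ _ φ => by
  obtain ⟨l, _, g, ψ, hψ⟩ := h X (e.symm.toLinearMap ∘ₗ φ)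
  refine ⟨l, inferInstance, g, e.toLinearMap ∘ₗ ψ, ?_⟩
  rw [LinearMap.comp_assoc, ← hψ]
  ext
  simp

theorem FactorsThroughFree.of_subsingleton [Subsingleton M] : FactorsThroughFree R M :=
  fun _ _ _ _ _ => ⟨Empty, inferInstance, 0, 0, Subsingleton.elim _ _⟩

theorem FactorsThroughFree.of_projective [Module.Projective R M] : FactorsThroughFree R M := by
  classical
  intro X _ _ _ φ
  obtain ⟨s, hs⟩ := (Module.projective_def' (R := R) (P := M)).1 inferInstance
  obtain ⟨S, hS⟩ := Module.Finite.fg_top (R := R) (M := X)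
  let T : Finset M := S.biUnion fun x => (s (φ x)).support
  let t (j : Fin T.card) : M := (T.equivFin.symm j).1
  refine ⟨Fin T.card, inferInstance,
    LinearMap.pi fun j => Finsupp.lapply (t j) ∘ₗ s ∘ₗ φ,
    (Pi.basisFun R _).constr ℕ t, ?_⟩
  refine LinearMap.ext_on hS fun x hx => ?_
  have h : Finsupp.linearCombination R id (s (φ x)) = φ x := LinearMap.congr_fun hs _
  rw [Finsupp.linearCombination_apply, Finsupp.sum_of_support_subset (s := T) _ (by
      intro y hy
      exact Finset.mem_biUnion.2 ⟨x, hx, hy⟩) _ (by simp), ← Finset.sum_coe_sort,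
      ← T.equivFin.symm.sum_comp] at h
  rw [← h]
  simp [Module.Basis.constr_apply_fintype, t]

theorem FactorsThroughFree.prod (hM : FactorsThroughFree R M) (hN : FactorsThroughFree R N) :
    FactorsThroughFree R (M × N) := fun X _ _ _ φ => by
  obtain ⟨l, _, g, ψ, h⟩ := hM X (LinearMap.fst R M N ∘ₗ φ)
  obtain ⟨l', _, g', ψ', h'⟩ := hN X (LinearMap.snd R M N ∘ₗ φ)
  let e := LinearEquiv.sumArrowLequivProdArrow l l' R R
  refine ⟨l ⊕ l', inferInstance, e.symm.toLinearMap ∘ₗ g.prod g', ψ.prodMap ψ' ∘ₗ e.toLinearMap, ?_⟩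
  ext x
  · have := LinearMap.congr_fun h x
    simpa using this
  · have := LinearMap.congr_fun h' x
    simpa using this

theorem FactorsThroughFree.projective [Module.FinitePresentation R M]
    (h : FactorsThroughFree R M) : Module.Projective R M := by
  obtain ⟨l, _, g, ψ, hψ⟩ := h M LinearMap.id
  exact Module.Projective.of_split g ψ hψ.symm

/-- Factor `X → M` as `ψ ∘ g`. The defect `f ∘ ψ` vanishes on the range of `g`, so it is a map from
the finitely presented cokernel of `g` to `N`. Factoring that map through a free module and lifting
to `M` gives a correction of `ψ` that leaves `ψ ∘ g` unchanged. -/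
theorem FactorsThroughFree.ker (hM : FactorsThroughFree R M) (hN : FactorsThroughFree R N)
    (f : M →ₗ[R] N) (hf : Function.Surjective f) : FactorsThroughFree R (LinearMap.ker f) := by
  intro X _ _ _ φ
  obtain ⟨l, _, g, ψ, hψ⟩ := hM X ((LinearMap.ker f).subtype ∘ₗ φ)
  let Q := (l → R) ⧸ LinearMap.range g
  have : Module.FinitePresentation R Q :=
    Module.finitePresentation_of_surjective (Submodule.mkQ _) (Submodule.mkQ_surjective _) (by
      rw [Submodule.ker_mkQ, LinearMap.range_eq_map]
      exact (Module.Finite.fg_top (R := R) (M := X)).map g)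
  let θ : Q →ₗ[R] N := (LinearMap.range g).liftQ (f ∘ₗ ψ) (by
    rw [LinearMap.range_le_ker_iff, LinearMap.comp_assoc, ← hψ]
    ext x
    exact (φ x).2)
  obtain ⟨l', _, g', ψ', hθ⟩ := hN Q θ
  obtain ⟨χ, hχ⟩ := Module.projective_lifting_property f ψ' hf
  refine ⟨l, inferInstance, g, (ψ - χ ∘ₗ g' ∘ₗ (LinearMap.range g).mkQ).codRestrict _ fun y => ?_,
    ?_⟩
  · rw [LinearMap.mem_ker, LinearMap.sub_apply, map_sub, sub_eq_zero]
    have h1 : f (χ (g' ((LinearMap.range g).mkQ y))) = f (ψ y) := by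
      rw [← LinearMap.comp_apply f, hχ, ← LinearMap.comp_apply ψ', ← hθ]
      rfl
    exact h1.symm
  · ext x
    have h0 : (LinearMap.range g).mkQ (g x) = 0 := by simp
    have := LinearMap.congr_fun hψ x
    simpa [h0] using this

variable (R) in
/-- The flat dimension of `M` is at most `n`, by recursion on `n`, where flatness is expressed as
`FactorsThroughFree`. -/
def FlatDimLE : ∀ (_ : ℕ) (M : Type u) [AddCommGroup M] [Module R M], Prop
  | 0, M, _, _ => FactorsThroughFree R M
  | n + 1, M, _, _ => ∃ (F : Type u) (_ : AddCommGroup F) (_ : Module R F) (π : F →ₗ[R] M),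
      FactorsThroughFree R F ∧ Function.Surjective π ∧ FlatDimLE n (LinearMap.ker π)

theorem FlatDimLE.of_equiv {n : ℕ} (h : FlatDimLE R n M) (e : M ≃ₗ[R] N) : FlatDimLE R n N := by
  cases n with
  | zero => exact FactorsThroughFree.of_equiv h e
  | succ n =>
    obtain ⟨F, _, _, π, hF, hπ, h⟩ := h
    refine ⟨F, inferInstance, inferInstance, e.toLinearMap ∘ₗ π, hF, e.surjective.comp hπ, ?_⟩
    rwa [LinearEquiv.ker_comp]

theorem FlatDimLE.prod {n : ℕ} {L : Type u} [AddCommGroup L] [Module R L] (h : FlatDimLE R n L)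
    (hM : FactorsThroughFree R M) : FlatDimLE R n (L × M) := by
  cases n with
  | zero => exact FactorsThroughFree.prod h hM
  | succ n =>
    obtain ⟨F, _, _, π, hF, hπ, h⟩ := h
    refine ⟨F × M, inferInstance, inferInstance, π.prodMap LinearMap.id, hF.prod hM,
      hπ.prodMap Function.surjective_id, h.of_equiv ?_⟩
    exact
      { toFun x := ⟨(x.1, 0), by simp⟩
        invFun x := ⟨x.1.1, congrArg Prod.fst (LinearMap.mem_ker.1 x.2)⟩
        map_add' x y := by ext <;> simp
        map_smul' r x := by ext <;> simp
        left_inv x := rfl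
        right_inv x := by
          have := congrArg Prod.snd (LinearMap.mem_ker.1 x.2)
          ext
          · rfl
          · exact this.symm }

/-- A flat cover `π` of `M` restricts to a cover of `ker f` by `ker (f ∘ π)`, which is flat, with
the same kernel as `π`. -/
theorem FlatDimLE.ker {n : ℕ} (hM : FlatDimLE R n M) (hN : FactorsThroughFree R N)
    (f : M →ₗ[R] N) (hf : Function.Surjective f) : FlatDimLE R n (LinearMap.ker f) := by
  cases n with
  | zero => exact FactorsThroughFree.ker hM hN f hf
  | succ n =>
    obtain ⟨F, _, _, π, hF, hπ, h⟩ := hM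
    refine ⟨LinearMap.ker (f ∘ₗ π), inferInstance, inferInstance,
      π.restrict (fun x hx => hx), hF.ker hN (f ∘ₗ π) (hf.comp hπ), ?_, h.of_equiv ?_⟩
    · rintro ⟨m, hm⟩
      obtain ⟨x, rfl⟩ := hπ m
      exact ⟨⟨x, hm⟩, rfl⟩
    · exact
        { toFun x := ⟨⟨x.1, by simp⟩, by ext; exact x.2⟩
          invFun x := ⟨x.1.1, congrArg Subtype.val (LinearMap.mem_ker.1 x.2)⟩
          map_add' x y := rfl
          map_smul' r x := rfl
          left_inv x := rfl
          right_inv x := rfl }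

/-- The kernel of a surjection from a projective module has smaller flat dimension. -/
theorem FlatDimLE.ker_of_projective {n : ℕ} (hM : FlatDimLE R (n + 1) M) {P : Type u}
    [AddCommGroup P] [Module R P] [Module.Projective R P] (π : P →ₗ[R] M)
    (hπ : Function.Surjective π) : FlatDimLE R n (LinearMap.ker π) := by
  obtain ⟨F, _, _, ε, hF, hε, h⟩ := hM
  obtain ⟨s, hs⟩ := Module.projective_lifting_property ε π hε
  -- As in Schanuel's lemma, `ker ε × P` maps onto `F`, and the kernel of this map is a copy of `ker
  -- π`.
  let g : (LinearMap.ker ε) × P →ₗ[R] F := (LinearMap.ker ε).subtype.coprod s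
  have hs' (p : P) : ε (s p) = π p := LinearMap.congr_fun hs p
  have hg : Function.Surjective g := fun x => by
    obtain ⟨p, hp⟩ := hπ (ε x)
    exact ⟨(⟨x - s p, by simp [hs', hp]⟩, p), by simp [g]⟩
  refine ((h.prod FactorsThroughFree.of_projective).ker hF g hg).of_equiv ?_
  have hk (x : LinearMap.ker g) : x.1.1.1 = - s x.1.2 :=
    eq_neg_of_add_eq_zero_left (LinearMap.mem_ker.1 x.2)
  exact
    { toFun x := ⟨x.1.2, by
        have := congrArg ε (hk x)
        rwa [map_neg, hs', LinearMap.mem_ker.1 x.1.1.2, eq_comm, neg_eq_zero] at this⟩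
      invFun p := ⟨(⟨- s p, by simp [hs']⟩, p), by simp [g]⟩
      map_add' x y := rfl
      map_smul' r x := rfl
      left_inv x := by
        ext
        · exact (hk x).symm
        · rfl
      right_inv x := rfl }

/-- Kernels of finite free covers stay finitely presented while their flat dimension drops, until a
finitely presented flat, hence projective, module is reached. -/
theorem FlatDimLE.hasProjectiveDimensionLE (hR : IsPseudoCoherent R R) (n : ℕ) :
    ∀ (M : Type u) [AddCommGroup M] [Module R M] [Module.FinitePresentation R M],
      FlatDimLE R n M → HasProjectiveDimensionLE (ModuleCat.of R M) n := by
  induction n with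
  | zero =>
    intro M _ _ _ h
    have : Module.Projective R M := FactorsThroughFree.projective h
    exact (projective_iff_hasProjectiveDimensionLE_zero _).1
      ((IsProjective.iff_projective M).1 this)
  | succ n ih =>
    intro M _ _ _ h
    obtain ⟨k, f, hf⟩ := Module.Finite.exists_fin' R M
    have := hR.finitePresentation_ker f
    have hk := ih _ (h.ker_of_projective f hf)
    exact (LinearMap.shortExact_shortComplexKer hf).hasProjectiveDimensionLT_X₃ (n + 1) hk
      inferInstance

end FlatDimension

/-! ### Flat resolutions and weak global dimension -/

section FlatDimensionComparison

variable {A : Type u} [Ring A]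

theorem HasFlatDimensionLE.mono {M : ModuleCat.{u} Aᵐᵒᵖ} {m n : ℕ} (h : HasFlatDimensionLE A M m)
    (hmn : m ≤ n) : HasFlatDimensionLE A M n := by
  obtain ⟨F, d, ε, hF, h0, h⟩ := h
  exact ⟨F, d, ε, hF, fun i hi => h0 i (by lia), h⟩

theorem HasFlatDimensionLE.flatDimLE {n : ℕ} {M : ModuleCat.{u} Aᵐᵒᵖ}
    (h : HasFlatDimensionLE A M n) : FlatDimLE Aᵐᵒᵖ n M := by
  induction n generalizing M with
  | zero =>
    obtain ⟨F, d, ε, hF, h0, hε, hd, -⟩ := h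
    have := h0 1 (by lia)
    have hi : Function.Injective ε := by
      rw [injective_iff_map_eq_zero]
      intro x hx
      obtain ⟨y, rfl⟩ := (hd x).1 hx
      rw [Subsingleton.elim y 0, map_zero]
    exact (isFlatRightModule_iff_factorsThroughFree.1 (hF 0)).of_equiv
      (LinearEquiv.ofBijective ε ⟨hi, hε⟩)
  | succ n ih =>
    obtain ⟨F, d, ε, hF, h0, hε, hd, hd'⟩ := h
    refine ⟨F 0, inferInstance, inferInstance, ε,
      isFlatRightModule_iff_factorsThroughFree.1 (hF 0), hε, ?_⟩
    refine ih (M := ModuleCat.of Aᵐᵒᵖ (LinearMap.ker ε)) ⟨fun i => F (i + 1), fun i => d (i + 1),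
      (d 0).codRestrict _ fun x => hd.apply_apply_eq_zero x, fun i => hF _,
      fun i hi => h0 _ (by lia), ?_, ?_, fun i => hd' _⟩
    · rintro ⟨x, hx⟩
      obtain ⟨y, rfl⟩ := (hd x).1 hx
      exact ⟨y, rfl⟩
    · intro x
      rw [← hd' 0 x]
      exact Subtype.ext_iff

theorem FlatDimLE.hasFlatDimensionLE {n : ℕ} {M : ModuleCat.{u} Aᵐᵒᵖ} (h : FlatDimLE Aᵐᵒᵖ n M) :
    HasFlatDimensionLE A M n := by
  induction n generalizing M with
  | zero =>
    refine ⟨fun i => Nat.casesOn i M fun _ => ModuleCat.of Aᵐᵒᵖ PUnit, fun i => 0,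
      LinearMap.id, ?_, ?_, Function.surjective_id, ?_, fun i x => ?_⟩
    · rintro (_ | i)
      · exact isFlatRightModule_iff_factorsThroughFree.2 h
      · exact isFlatRightModule_iff_factorsThroughFree.2
          (FactorsThroughFree.of_subsingleton (M := PUnit))
    · rintro (_ | i) hi
      · lia
      · exact inferInstanceAs (Subsingleton PUnit)
    · intro x
      simp [eq_comm]
    · exact ⟨fun _ => ⟨0, rfl⟩, fun _ => rfl⟩
  | succ n ih =>
    obtain ⟨P, _, _, π, hP, hπ, h⟩ := h
    obtain ⟨F, d, ε, hF, h0, hε, hd, hd'⟩ := ih (M := ModuleCat.of Aᵐᵒᵖ (LinearMap.ker π)) h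
    refine ⟨fun i => Nat.casesOn i (ModuleCat.of Aᵐᵒᵖ P) F,
      fun i => Nat.casesOn i ((LinearMap.ker π).subtype ∘ₗ ε) d, π, ?_, ?_, hπ, ?_, ?_⟩
    · rintro (_ | i)
      · exact isFlatRightModule_iff_factorsThroughFree.2 hP
      · exact hF i
    · rintro (_ | i) hi
      · lia
      · exact h0 i (by lia)
    · intro x
      constructor
      · intro hx
        obtain ⟨y, hy⟩ := hε ⟨x, hx⟩
        exact ⟨y, congrArg Subtype.val hy⟩
      · rintro ⟨y, rfl⟩
        exact (ε y).2
    · rintro (_ | i)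
      · intro x
        rw [← hd x]
        exact (Subtype.ext_iff (a1 := ε x) (a2 := 0)).symm
      · exact hd' i

theorem weakGlobalDimension_lt_top_iff : weakGlobalDimension A < ⊤ ↔
    ∃ n : ℕ, ∀ (M : Type u) [AddCommGroup M] [Module Aᵐᵒᵖ M], FlatDimLE Aᵐᵒᵖ n M := by
  constructor
  · intro h
    obtain ⟨n, hn⟩ := ENat.ne_top_iff_exists.1 h.ne
    refine ⟨n, fun M _ _ => ?_⟩
    -- A strict bound by `n + 1` yields a resolution from the infimum, and its length is then at
    -- most `n`.
    have hM : flatDimension A (ModuleCat.of Aᵐᵒᵖ M) < ((n + 1 : ℕ) : ℕ∞) := by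
      refine (le_iSup (flatDimension A) (ModuleCat.of Aᵐᵒᵖ M)).trans_lt ?_
      rw [← weakGlobalDimension, ← hn]
      exact_mod_cast Nat.lt_succ_self n
    simp only [flatDimension, iInf_lt_iff] at hM
    obtain ⟨m, hm, hmn⟩ := hM
    have : m ≤ n := Nat.le_of_lt_succ (by exact_mod_cast hmn)
    exact (hm.mono this).flatDimLE
  · rintro ⟨n, hn⟩
    refine lt_of_le_of_lt (iSup_le fun M => ?_) (ENat.natCast_lt_top n)
    exact iInf₂_le n (hn M).hasFlatDimensionLE

end FlatDimensionComparison

/-! ### From finitely presented modules to all modules -/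

section LocallyBoundedDimension

variable {R : Type u} [Ring R] {M L P : Type u} [AddCommGroup M] [Module R M]
  [AddCommGroup L] [Module R L] [AddCommGroup P] [Module R P]

theorem Module.Basis.exists_finset_le_span {ι : Type*} (b : Module.Basis ι R P) (S : Submodule R P)
    (hS : S.FG) : ∃ T : Finset ι, S ≤ Submodule.span R (b '' T) := by
  classical
  obtain ⟨s, rfl⟩ := hS
  refine ⟨s.biUnion fun x => (b.repr x).support, Submodule.span_le.2 fun x hx => ?_⟩
  rw [SetLike.mem_coe, b.mem_span_image]
  exact_mod_cast Finset.subset_biUnion_of_mem (fun x => (b.repr x).support) hx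

theorem Module.Basis.projective_span_image {ι : Type*} (b : Module.Basis ι R P) (T : Set ι) :
    Module.Projective R (Submodule.span R (b '' T)) := by
  have : b '' T = Set.range fun i : T => b i := by rw [Set.image_eq_range]
  rw [this]
  exact .of_basis (Module.Basis.span (b.linearIndependent.comp _ Subtype.val_injective))

variable (R) in
/-- Every finitely generated submodule of `M` is contained in a finitely presented submodule of
projective dimension less than `j`. -/
def LocallyProjectiveDimensionLT (j : ℕ) (M : Type u) [AddCommGroup M] [Module R M] : Prop :=
  ∀ S : Submodule R M, S.FG → ∃ Q : Submodule R M, S ≤ Q ∧ Module.FinitePresentation R Q ∧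
    HasProjectiveDimensionLT (ModuleCat.of R Q) j

theorem ModuleCat.hasProjectiveDimensionLT_ker {j : ℕ} [Module.Projective R P] (f : P →ₗ[R] L)
    (hf : Function.Surjective f) (hL : HasProjectiveDimensionLT (ModuleCat.of R L) (j + 2)) :
    HasProjectiveDimensionLT (ModuleCat.of R (LinearMap.ker f)) (j + 1) :=
  (LinearMap.shortExact_shortComplexKer hf).hasProjectiveDimensionLT_X₁ (j + 1)
    (hasProjectiveDimensionLT_of_ge (ModuleCat.of R P) 1 (j + 1) (by lia)) hL

theorem ModuleCat.hasProjectiveDimensionLT_of_linearEquiv {j : ℕ}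
    (h : HasProjectiveDimensionLT (ModuleCat.of R M) j) (e : M ≃ₗ[R] L) :
    HasProjectiveDimensionLT (ModuleCat.of R L) j :=
  hasProjectiveDimensionLT_of_iso e.toModuleIso j

/-- `S` itself serves as `Q`: it embeds in the span `F` of finitely many basis vectors and is the
first syzygy of the finitely presented module `F / S`. -/
theorem locallyProjectiveDimensionLT_ker_of_forall (hR : IsPseudoCoherent R R) {j : ℕ}
    (h : ∀ (X : Type u) [AddCommGroup X] [Module R X] [Module.FinitePresentation R X],
      HasProjectiveDimensionLT (ModuleCat.of R X) (j + 2))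
    {ι : Type*} (b : Module.Basis ι R P) (π : P →ₗ[R] M) :
    LocallyProjectiveDimensionLT R (j + 1) (LinearMap.ker π) := by
  intro S hS
  refine ⟨S, le_rfl, ?_⟩
  obtain ⟨T, hT⟩ := b.exists_finset_le_span (S.map (LinearMap.ker π).subtype) (hS.map _)
  let F := Submodule.span R (b '' (T : Set ι))
  have : Module.Projective R F := b.projective_span_image T
  have : Module.Finite R F :=
    Module.Finite.iff_fg.2 (Submodule.fg_span (T.finite_toSet.image _))
  let f : S →ₗ[R] F := ((LinearMap.ker π).subtype ∘ₗ S.subtype).codRestrict F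
    fun x => hT ⟨x.1, x.2, rfl⟩
  have hf : Function.Injective f := fun x y hxy =>
    Subtype.ext (Subtype.ext (congrArg (fun z => z.1) hxy))
  have hfg : (LinearMap.range f).FG := by
    have := Module.Finite.iff_fg.2 hS
    rw [LinearMap.range_eq_map]
    exact (Module.Finite.fg_top (R := R) (M := S)).map f
  let e : S ≃ₗ[R] LinearMap.range f := LinearEquiv.ofInjective f hf
  have : Module.FinitePresentation R F := Module.finitePresentation_of_projective R F
  have := hR.of_finitePresentation (M := F) _ hfg
  have : Module.FinitePresentation R (F ⧸ LinearMap.range f) :=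
    Module.finitePresentation_of_surjective _ (Submodule.mkQ_surjective _)
      (by rwa [Submodule.ker_mkQ])
  refine ⟨.of_equiv e.symm, ?_⟩
  exact ModuleCat.hasProjectiveDimensionLT_of_linearEquiv
    (ModuleCat.hasProjectiveDimensionLT_ker (Submodule.mkQ _) (Submodule.mkQ_surjective _)
      (h (F ⧸ LinearMap.range f))) ((LinearEquiv.ofEq _ _ (Submodule.ker_mkQ _)).trans e.symm)

/-- Every element of `M` is the image of a basis vector. Let `Q` contain the elements labelling the
basis vectors needed for `S`, and add generators of `Q` to these labels. The resulting finite free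
`F` maps onto `Q`, and the kernel of `F → Q` contains `S` and has smaller dimension than `Q`. -/
theorem LocallyProjectiveDimensionLT.ker (hR : IsPseudoCoherent R R) {j : ℕ}
    (h : LocallyProjectiveDimensionLT R (j + 2) M) (b : Module.Basis M R P) (π : P →ₗ[R] M)
    (hπ : ∀ m, π (b m) = m) :
    LocallyProjectiveDimensionLT R (j + 1) (LinearMap.ker π) := by
  classical
  intro S hS
  obtain ⟨T₀, hT₀⟩ := b.exists_finset_le_span (S.map (LinearMap.ker π).subtype) (hS.map _)
  obtain ⟨Q, hQ, _, hpd⟩ := h (Submodule.span R T₀) ⟨T₀, rfl⟩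
  obtain ⟨T₁, hT₁⟩ := Module.Finite.iff_fg.1 (inferInstance : Module.Finite R Q)
  let T := T₀ ∪ T₁
  have hT : Submodule.span R (T : Set M) = Q := by
    rw [Finset.coe_union, Submodule.span_union, hT₁, sup_eq_right.2 hQ]
  let F := Submodule.span R (b '' (T : Set M))
  have : Module.Projective R F := b.projective_span_image T
  have : Module.Finite R F :=
    Module.Finite.iff_fg.2 (Submodule.fg_span (T.finite_toSet.image _))
  let f : F →ₗ[R] M := π ∘ₗ F.subtype
  have hf : LinearMap.range f = Q := by
    rw [LinearMap.range_comp, Submodule.range_subtype, ← hT, Submodule.map_span, Set.image_image]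
    simp [hπ]
  let g : F →ₗ[R] Q := f.codRestrict Q (fun x => hf ▸ ⟨x, rfl⟩)
  have hg : Function.Surjective g := fun ⟨y, hy⟩ => by
    obtain ⟨x, rfl⟩ := hf.symm ▸ hy
    exact ⟨x, rfl⟩
  have : Module.FinitePresentation R F := Module.finitePresentation_of_projective R F
  have := hR.finitePresentation_ker g
  let e : LinearMap.ker g ≃ₗ[R] F.comap (LinearMap.ker π).subtype :=
    { toFun x := ⟨⟨x.1.1, congrArg Subtype.val (LinearMap.mem_ker.1 x.2)⟩, x.1.2⟩
      invFun x := ⟨⟨x.1.1, x.2⟩, Subtype.ext (LinearMap.mem_ker.1 x.1.2)⟩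
      map_add' x y := rfl
      map_smul' r x := rfl
      left_inv x := rfl
      right_inv x := rfl }
  refine ⟨F.comap (LinearMap.ker π).subtype, ?_, .of_equiv e,
    ModuleCat.hasProjectiveDimensionLT_of_linearEquiv
      (ModuleCat.hasProjectiveDimensionLT_ker g hg hpd) e⟩
  rw [← Submodule.map_le_iff_le_comap]
  exact hT₀.trans (Submodule.span_mono (Set.image_mono (by simp [T])))

theorem LocallyProjectiveDimensionLT.factorsThroughFree (h : LocallyProjectiveDimensionLT R 1 M) :
    FactorsThroughFree R M := by
  intro X _ _ _ φ
  obtain ⟨Q, hQ, _, hpd⟩ := h (LinearMap.range φ) (by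
    rw [LinearMap.range_eq_map]
    exact (Module.Finite.fg_top (R := R) (M := X)).map φ)
  have : Module.Projective R Q := (IsProjective.iff_projective Q).2 inferInstance
  obtain ⟨l, _, g, ψ, h⟩ := FactorsThroughFree.of_projective (R := R) (M := Q) X
    (φ.codRestrict Q fun x => hQ ⟨x, rfl⟩)
  exact ⟨l, inferInstance, g, Q.subtype ∘ₗ ψ, by
    rw [LinearMap.comp_assoc, ← h, LinearMap.subtype_comp_codRestrict]⟩

theorem FlatDimLE.succ_of_finsupp {n : ℕ}
    (h : FlatDimLE R n (LinearMap.ker (Finsupp.linearCombination R (id : M → M)))) :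
    FlatDimLE R (n + 1) M :=
  ⟨M →₀ R, inferInstance, inferInstance, Finsupp.linearCombination R id,
    FactorsThroughFree.of_projective, Finsupp.linearCombination_id_surjective R M, h⟩

theorem LocallyProjectiveDimensionLT.flatDimLE (hR : IsPseudoCoherent R R) {m : ℕ}
    (h : LocallyProjectiveDimensionLT R (m + 1) M) : FlatDimLE R m M := by
  induction m generalizing M with
  | zero => exact h.factorsThroughFree
  | succ m ih =>
    exact (ih (h.ker hR Finsupp.basisSingleOne (Finsupp.linearCombination R id)
      (by simp))).succ_of_finsupp

theorem weakGlobalDimension_lt_top_iff_projectiveDimension_le {A : Type u} [Ring A]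
    (hA : IsRightCoherent A) : weakGlobalDimension A < ⊤ ↔
      ∃ n : ℕ, ∀ M : ModuleCat.{u} Aᵐᵒᵖ, Module.FinitePresentation Aᵐᵒᵖ M →
        projectiveDimension M ≤ (n : WithBot ℕ∞) := by
  have hR := hA.isPseudoCoherent
  simp only [weakGlobalDimension_lt_top_iff, projectiveDimension_le_iff]
  constructor
  · rintro ⟨n, h⟩
    exact ⟨n, fun M _ => FlatDimLE.hasProjectiveDimensionLE hR n M (h M)⟩
  -- The bound `n + 1` on flat dimension comes from the initial free cover. Weakening `< n + 1` to
  -- `< n + 2` lets the syzygy lemma apply even for `n = 0`.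
  · rintro ⟨n, h⟩
    exact ⟨n + 1, fun M _ _ => ((locallyProjectiveDimensionLT_ker_of_forall hR (fun X _ _ _ =>
      have := h (ModuleCat.of _ X) inferInstance
      hasProjectiveDimensionLT_of_ge (ModuleCat.of _ X) (n + 1) (n + 2) (by lia))
      Finsupp.basisSingleOne _).flatDimLE hR).succ_of_finsupp⟩

end LocallyBoundedDimension

noncomputable section

/-! ### Projective modules in the additive closure of the ring -/

namespace CategoryTheory.ObjectProperty

variable {T : Type*} [Category* T] [Preadditive T]

/-- Closure under finite direct sums, for a property which is stable under retracts. -/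
theorem prop_of_sum_eq_id [HasZeroObject T] [HasBinaryBiproducts T] (W : ObjectProperty T)
    [W.IsStableUnderRetracts] [W.ContainsZero]
    (hW : ∀ X Y, W X → W Y → W (X ⊞ Y)) {J : Type*} [Fintype J] {f : J → T} {Y : T}
    (i : ∀ j, f j ⟶ Y) (p : ∀ j, Y ⟶ f j) (h : ∑ j, p j ≫ i j = 𝟙 Y) (hf : ∀ j, W (f j)) :
    W Y := by
  classical
  -- Each partial sum factors through a finite direct sum of the `f j`; no orthogonality of the maps
  -- is needed, so splittings of `R^n → P` qualify.
  have key (s : Finset J) : ∃ (Z : T) (_ : W Z) (a : Y ⟶ Z) (b : Z ⟶ Y),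
      a ≫ b = ∑ j ∈ s, p j ≫ i j := by
    induction s using Finset.induction_on with
    | empty =>
      obtain ⟨Z, _, hZ⟩ := W.exists_prop_of_containsZero
      exact ⟨Z, hZ, 0, 0, by simp⟩
    | insert j s hj ih =>
      obtain ⟨Z, hZ, a, b, hab⟩ := ih
      exact ⟨f j ⊞ Z, hW _ _ (hf j) hZ, biprod.lift (p j) a, biprod.desc (i j) b, by
        rw [Finset.sum_insert hj, ← hab, biprod.lift_desc]⟩
  obtain ⟨Z, hZ, a, b, hab⟩ := key Finset.univ
  exact W.prop_of_retract ⟨a, b, hab.trans h⟩ hZ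

theorem retractClosure_binaryProductsClosure_biprod [HasBinaryBiproducts T]
    (P : ObjectProperty T) (X Y : T) (hX : P.binaryProductsClosure.retractClosure X)
    (hY : P.binaryProductsClosure.retractClosure Y) :
    P.binaryProductsClosure.retractClosure (X ⊞ Y) := by
  obtain ⟨X', hX', ⟨rX⟩⟩ := hX
  obtain ⟨Y', hY', ⟨rY⟩⟩ := hY
  refine ⟨X' ⊞ Y', prop_of_isLimit_binaryFan _ (BinaryBiproduct.isLimit X' Y') hX' hY',
    ⟨⟨biprod.map rX.i rY.i, biprod.map rX.r rY.r, ?_⟩⟩⟩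
  ext <;> simp

end CategoryTheory.ObjectProperty

section SingleObjects

variable {R : Type u} [Ring R]

theorem isStrictlyPerfect_single (P : ModuleCat.{u} R) [Module.Finite R P] [Module.Projective R P]
    (i : ℤ) : IsStrictlyPerfect ((CochainComplex.singleFunctor (ModuleCat.{u} R) i).obj P) := by
  refine ⟨⟨i, inferInstance⟩, ⟨i, inferInstance⟩, fun j => ?_⟩
  by_cases h : j = i
  · subst h
    let e := (HomologicalComplex.singleObjXSelf (ComplexShape.up ℤ) j P).toLinearEquiv.symm
    exact ⟨Module.Finite.equiv e, Module.Projective.of_equiv e⟩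
  · have : Subsingleton (((CochainComplex.singleFunctor (ModuleCat.{u} R) i).obj P).X j) :=
      ModuleCat.subsingleton_of_isZero
      (HomologicalComplex.isZero_single_obj_X (ComplexShape.up ℤ) i P j h)
    exact ⟨inferInstance, inferInstance⟩

variable [HasDerivedCategory.{w} (ModuleCat.{u} R)]

open DerivedCategory

theorem perfectComplexes_single (P : ModuleCat.{u} R) [Module.Finite R P] [Module.Projective R P]
    (i : ℤ) : perfectComplexes.{w} R ((singleFunctor (ModuleCat.{u} R) i).obj P) :=
  ⟨_, isStrictlyPerfect_single P i, ⟨(singleFunctorIsoCompQ _ i).app P⟩⟩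

/-- A finitely generated projective module in degree `i`, as a perfect complex. -/
def DPerf.single (P : ModuleCat.{u} R) [Module.Finite R P] [Module.Projective R P] (i : ℤ) :
    DPerf.{w} R :=
  ⟨_, perfectComplexes_single P i⟩

variable (R) in
/-- The shifts, finite direct sums and direct summands of `R` in the category of perfect
complexes. -/
abbrev DPerf.additiveClosure : ObjectProperty (DPerf.{w} R) :=
  ((ObjectProperty.singleton (DPerf.single (ModuleCat.of R R) 0)).shiftClosure ℤ
    ).binaryProductsClosure.retractClosure

theorem DPerf.additiveClosure_of_sum_eq_id {J : Type*} [Fintype J] {f : J → DPerf.{w} R}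
    {Y : DPerf.{w} R} (i : ∀ j, f j ⟶ Y) (p : ∀ j, Y ⟶ f j) (h : ∑ j, p j ≫ i j = 𝟙 Y)
    (hf : ∀ j, DPerf.additiveClosure R (f j)) : DPerf.additiveClosure R Y :=
  ObjectProperty.prop_of_sum_eq_id _
    (ObjectProperty.retractClosure_binaryProductsClosure_biprod _) i p h hf

theorem DPerf.additiveClosure_single_self (i : ℤ) :
    DPerf.additiveClosure.{w} R (DPerf.single (ModuleCat.of R R) i) := by
  let G : DPerf.{w} R := DPerf.single (ModuleCat.of R R) 0
  have e : DPerf.single (ModuleCat.of R R) i ≅ G⟦-i⟧ :=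
    (perfectComplexes.{w} R).ι.preimageIso
      (((singleFunctors (ModuleCat.{u} R)).shiftIso (-i) i 0 (by lia)).symm.app (ModuleCat.of R R)
        ≪≫ ((perfectComplexes.{w} R).ι.commShiftIso (-i)).symm.app G)
  refine ObjectProperty.prop_of_iso _ e.symm ?_
  have h : (ObjectProperty.singleton G).shiftClosure ℤ (G⟦-i⟧) :=
    ObjectProperty.IsStableUnderShiftBy.le_shift (a := -i) G
      (ObjectProperty.le_shiftClosure _ _ ((ObjectProperty.singleton_iff _ _).2 rfl))
  exact ObjectProperty.le_retractClosure _ _ (ObjectProperty.le_limitsClosure _ _ _ h)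

theorem DPerf.additiveClosure_single (P : ModuleCat.{u} R) [Module.Finite R P]
    [Module.Projective R P] (i : ℤ) : DPerf.additiveClosure.{w} R (DPerf.single P i) := by
  obtain ⟨n, f, g, -, -, hfg⟩ := Module.Finite.exists_comp_eq_id_of_projective R P
  let S := singleFunctor (ModuleCat.{u} R) i
  let a (j : Fin n) : ModuleCat.of R R ⟶ P :=
    ModuleCat.ofHom (f ∘ₗ LinearMap.single R (fun _ => R) j)
  let b (j : Fin n) : P ⟶ ModuleCat.of R R := ModuleCat.ofHom (LinearMap.proj j ∘ₗ g)
  have hab : ∑ j, b j ≫ a j = 𝟙 P := by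
    ext x
    have := LinearMap.congr_fun hfg x
    simp only [a, b, ModuleCat.hom_sum, LinearMap.sum_apply, ModuleCat.hom_comp,
      ModuleCat.hom_ofHom, LinearMap.comp_apply, LinearMap.proj_apply, LinearMap.single_apply]
    rw [← map_sum, Finset.univ_sum_single]
    exact this
  let a' (j : Fin n) : DPerf.single (ModuleCat.of R R) i ⟶ DPerf.single P i :=
    (perfectComplexes.{w} R).ι.preimage (S.map (a j))
  let b' (j : Fin n) : DPerf.single P i ⟶ DPerf.single (ModuleCat.of R R) i :=
    (perfectComplexes.{w} R).ι.preimage (S.map (b j))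
  have ha (j : Fin n) : (perfectComplexes.{w} R).ι.map (a' j) = S.map (a j) :=
    Functor.map_preimage _ _
  have hb (j : Fin n) : (perfectComplexes.{w} R).ι.map (b' j) = S.map (b j) :=
    Functor.map_preimage _ _
  refine DPerf.additiveClosure_of_sum_eq_id a' b' ?_ fun _ => DPerf.additiveClosure_single_self i
  apply (perfectComplexes.{w} R).ι.map_injective
  rw [Functor.map_sum]
  refine Eq.trans ?_ ((congrArg S.map hab).trans (S.map_id P))
  rw [Functor.map_sum]
  refine Finset.sum_congr rfl fun j _ => ?_
  exact (Functor.map_comp _ _ _).trans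
    ((congrArg₂ (· ≫ ·) (hb j) (ha j)).trans (S.map_comp _ _).symm)

end SingleObjects

end

noncomputable section

/-! ### Cohomology and maps from projectives in a single degree -/

section Homology

open DerivedCategory HomologicalComplex

theorem finitePresentation_homology {R : Type u} [Ring R] (hR : IsPseudoCoherent R R)
    (K : CochainComplex (ModuleCat.{u} R) ℤ)
    (hK : ∀ i : ℤ, Module.Finite R (K.X i) ∧ Module.Projective R (K.X i)) (i : ℤ) :
    Module.FinitePresentation R (K.homology i) := by
  have hfp (j : ℤ) : Module.FinitePresentation R (K.X j) := by
    obtain ⟨_, _⟩ := hK j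
    exact Module.finitePresentation_of_projective R _
  have : Module.FinitePresentation R (K.sc i).X₁ := hfp _
  have : Module.FinitePresentation R (K.sc i).X₂ := hfp _
  have : Module.FinitePresentation R (K.sc i).X₃ := hfp _
  have := hR.finitePresentation_ker (K.sc i).g.hom
  have h : Module.FinitePresentation R
      (LinearMap.ker (K.sc i).g.hom ⧸ LinearMap.range (K.sc i).moduleCatToCycles) :=
    Module.finitePresentation_of_surjective (LinearMap.range (K.sc i).moduleCatToCycles).mkQ
      (Submodule.mkQ_surjective _) (by
        rw [Submodule.ker_mkQ, LinearMap.range_eq_map]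
        exact (Module.Finite.fg_top (R := R) (M := (K.sc i).X₁)).map _)
  have : Module.FinitePresentation R (K.sc i).moduleCatLeftHomologyData.H := h
  exact .of_equiv (K.sc i).moduleCatHomologyIso.toLinearEquiv.symm

variable {C : Type*} [Category* C] [Abelian C]

/-- Projectivity lifts `f` to the cycles, and a map to the cycles is a chain map from `P` in degree
`i`. -/
theorem CochainComplex.exists_homologyMap_single_eq (K : CochainComplex C ℤ) (P : C) [Projective P]
    (i : ℤ) (f : P ⟶ K.homology i) :
    ∃ φ : (HomologicalComplex.single C (ComplexShape.up ℤ) i).obj P ⟶ K,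
      homologyMap φ i = (singleObjHomologySelfIso (ComplexShape.up ℤ) i P).hom ≫ f := by
  let l : P ⟶ K.cycles i := Projective.factorThru f (K.homologyπ i)
  have hl : l ≫ K.homologyπ i = f := Projective.factorThru_comp _ _
  let φ := mkHomFromSingle (K := K) (j := i) (l ≫ K.iCycles i) (by simp)
  have hφ : cyclesMap φ i = (singleObjCyclesSelfIso (ComplexShape.up ℤ) i P).hom ≫ l := by
    rw [← cancel_mono (K.iCycles i), cyclesMap_i, mkHomFromSingle_f, singleObjCyclesSelfIso_hom]
    simp
  refine ⟨φ, ?_⟩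
  rw [← cancel_epi (homologyπ _ i), homologyπ_naturality, hφ, Category.assoc, hl,
    homologyπ_singleObjHomologySelfIso_hom_assoc]

variable [HasDerivedCategory.{w} C]

/-- The homology of the image of a complex in the derived category. -/
def DerivedCategory.homologyQIso (K : CochainComplex C ℤ) (i : ℤ) :
    (homologyFunctor C i).obj (Q.obj K) ≅ K.homology i :=
  (homologyFunctorFactors C i).app K

theorem DerivedCategory.homologyQIso_hom_naturality {K L : CochainComplex C ℤ} (φ : K ⟶ L)
    (i : ℤ) : (homologyFunctor C i).map (Q.map φ) ≫ (homologyQIso L i).hom =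
      (homologyQIso K i).hom ≫ homologyMap φ i :=
  homologyFunctorFactors_hom_naturality φ i

/-- A map from a projective object to the cohomology in degree `i` is induced by a map from the
object in degree `i`. -/
theorem DerivedCategory.exists_homologyFunctor_map_single_eq (X : DerivedCategory.{w} C) (P : C)
    [Projective P] (i : ℤ) (f : P ⟶ (homologyFunctor C i).obj X) :
    ∃ (φ : (singleFunctor C i).obj P ⟶ X)
      (e : (homologyFunctor C i).obj ((singleFunctor C i).obj P) ≅ P),
      (homologyFunctor C i).map φ = e.hom ≫ f := by
  let K := Q.objPreimage X
  let eX : Q.obj K ≅ X := Q.objObjPreimageIso X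
  obtain ⟨φ, hφ⟩ := CochainComplex.exists_homologyMap_single_eq K P i
    (f ≫ (homologyFunctor C i).map eX.inv ≫ (homologyQIso K i).hom)
  let s : (singleFunctor C i).obj P ≅
      Q.obj ((HomologicalComplex.single C (ComplexShape.up ℤ) i).obj P) :=
    (singleFunctorIsoCompQ C i).app P
  refine ⟨s.hom ≫ Q.map φ ≫ eX.hom, (homologyFunctor C i).mapIso s ≪≫ homologyQIso _ i ≪≫
    singleObjHomologySelfIso (ComplexShape.up ℤ) i P, ?_⟩
  have hn := homologyQIso_hom_naturality φ i
  rw [hφ, ← Iso.eq_comp_inv] at hn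
  rw [Functor.map_comp, Functor.map_comp, hn]
  simp only [Category.assoc, Iso.hom_inv_id_assoc, Iso.map_inv_hom_id, Category.comp_id,
    Iso.trans_hom]
  rfl

theorem DerivedCategory.isZero_homologyFunctor_single (P : C) {i j : ℤ} (h : i ≠ j) :
    IsZero ((homologyFunctor C i).obj ((singleFunctor C j).obj P)) := by
  rcases lt_or_gt_of_ne h with h | h
  · exact isZero_of_isGE _ j i h
  · exact isZero_of_isLE _ j i h

end Homology

/-! ### Cohomology of perfect complexes -/

section Resolution

open DerivedCategory

variable {R : Type u} [Ring R] [HasDerivedCategory.{w} (ModuleCat.{u} R)]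

variable (R) in
/-- The homology of perfect complexes. -/
abbrev DPerf.homology (i : ℤ) : DPerf.{w} R ⥤ ModuleCat.{u} R :=
  (perfectComplexes.{w} R).ι ⋙ homologyFunctor (ModuleCat.{u} R) i

theorem DPerf.finitePresentation_homology (hR : IsPseudoCoherent R R) (X : DPerf.{w} R) (i : ℤ) :
    Module.FinitePresentation R ((DPerf.homology R i).obj X) := by
  obtain ⟨K, ⟨-, -, hK⟩, ⟨e⟩⟩ := X.property
  have := _root_.finitePresentation_homology hR K hK i
  exact .of_equiv ((homologyFunctor _ i).mapIso e ≪≫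
    homologyQIso K i).toLinearEquiv.symm

theorem DPerf.exists_isZero_homology (X : DPerf.{w} R) :
    ∃ s : Finset ℤ, ∀ i, i ∉ s → IsZero ((DPerf.homology R i).obj X) := by
  obtain ⟨K, ⟨⟨a, _⟩, ⟨b, _⟩, -⟩, ⟨e⟩⟩ := X.property
  refine ⟨Finset.Icc a b, fun i hi => ?_⟩
  refine IsZero.of_iso ?_ ((homologyFunctor _ i).mapIso e)
  rcases lt_or_ge i a with h | h
  · exact isZero_of_isGE _ a i h
  · exact isZero_of_isLE _ b i (by simp at hi; lia)

/-- A choice of a finitely generated projective module mapping onto the homology, which is an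
isomorphism if the homology is projective. -/
theorem DPerf.exists_epi_homology (hR : IsPseudoCoherent R R) (X : DPerf.{w} R) (i : ℤ) :
    ∃ (P : ModuleCat.{u} R) (_ : Module.Finite R P) (_ : Module.Projective R P)
      (f : P ⟶ (DPerf.homology R i).obj X), Epi f ∧
      (Projective ((DPerf.homology R i).obj X) → Mono f) := by
  have := X.finitePresentation_homology hR i
  by_cases h : Projective ((DPerf.homology R i).obj X)
  · exact ⟨(DPerf.homology R i).obj X, inferInstance, (IsProjective.iff_projective _).2 h, 𝟙 _, inferInstance,
      fun _ => inferInstance⟩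
  · obtain ⟨n, f, hf⟩ := Module.Finite.exists_fin' R
      ((DPerf.homology R i).obj X)
    exact ⟨ModuleCat.of R (Fin n → R), inferInstance, inferInstance, ModuleCat.ofHom f,
      (ModuleCat.epi_iff_surjective _).2 hf, fun h' => (h h').elim⟩

theorem DPerf.exists_homology_map_single_eq (X : DPerf.{w} R) (P : ModuleCat.{u} R)
    [Module.Finite R P] [Module.Projective R P] (i : ℤ) (f : P ⟶ (DPerf.homology R i).obj X) :
    ∃ (φ : DPerf.single P i ⟶ X) (e : (DPerf.homology R i).obj (DPerf.single P i) ≅ P),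
      (DPerf.homology R i).map φ = e.hom ≫ f := by
  have : Projective P := (IsProjective.iff_projective P).1 inferInstance
  obtain ⟨φ, e, h⟩ := exists_homologyFunctor_map_single_eq X.obj P i f
  exact ⟨ObjectProperty.homMk φ, e, h⟩

end Resolution

end

noncomputable section

/-! ### Generation by the ring in boundedly many steps -/

section Generation

open DerivedCategory

variable {R : Type u} [Ring R] [HasDerivedCategory.{w} (ModuleCat.{u} R)]

theorem Functor.isIso_map_biproduct_ι {C D : Type*} [Category* C] [Category* D] [Preadditive C]
    [Preadditive D] (F : C ⥤ D) [F.Additive] {J : Type} [Fintype J] (f : J → C) [HasBiproduct f]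
    (j : J) (h : ∀ k, k ≠ j → IsZero (F.obj (f k))) : IsIso (F.map (biproduct.ι f j)) := by
  refine ⟨F.map (biproduct.π f j), by rw [← F.map_comp, biproduct.ι_π_self, F.map_id], ?_⟩
  rw [← F.map_comp, ← F.map_id, ← biproduct.total, F.map_sum, Finset.sum_eq_single j]
  · intro k _ hk
    rw [F.map_comp, (h k hk).eq_of_tgt (F.map (biproduct.π f k)) 0, zero_comp]
  · simp

theorem Functor.isZero_map_biproduct {C D : Type*} [Category* C] [Category* D] [Preadditive C]
    [Preadditive D] (F : C ⥤ D) [F.Additive] {J : Type} [Fintype J] (f : J → C) [HasBiproduct f]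
    (h : ∀ k, IsZero (F.obj (f k))) : IsZero (F.obj (⨁ f)) := by
  rw [IsZero.iff_id_eq_zero, ← F.map_id, ← biproduct.total, F.map_sum]
  refine Finset.sum_eq_zero fun k _ => ?_
  rw [F.map_comp, (h k).eq_of_tgt (F.map (biproduct.π f k)) 0, zero_comp]

/-- Only finitely many cohomology modules are nonzero, so one projective for each of these degrees
gives a finite sum, and only the `j`-th summand contributes in degree `j`. -/
theorem DPerf.exists_epi_of_additiveClosure (hR : IsPseudoCoherent R R) (X : DPerf.{w} R) :
    ∃ (B : DPerf.{w} R) (φ : B ⟶ X), DPerf.additiveClosure R B ∧ ∀ j,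
      Projective ((DPerf.homology R j).obj B) ∧ Epi ((DPerf.homology R j).map φ) ∧
      (Projective ((DPerf.homology R j).obj X) → Mono ((DPerf.homology R j).map φ)) := by
  obtain ⟨s, hs⟩ := X.exists_isZero_homology
  choose P hP hP' f hf hf' using X.exists_epi_homology hR
  have hP'' (i : ℤ) : Projective (P i) := (IsProjective.iff_projective (P i)).1 (hP' i)
  choose φ e hφ using fun i => X.exists_homology_map_single_eq (P i) i (f i)
  let b (i : s) : DPerf.{w} R := DPerf.single (P i) i
  let ψ (i : s) : b i ⟶ X := φ i
  have hz (i : s) (j : ℤ) (hij : j ≠ i) : IsZero ((DPerf.homology R j).obj (b i)) :=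
    isZero_homologyFunctor_single _ hij
  refine ⟨⨁ b, biproduct.desc ψ, DPerf.additiveClosure_of_sum_eq_id (biproduct.ι b)
    (biproduct.π b) biproduct.total fun i => DPerf.additiveClosure_single (P i) i, fun j => ?_⟩
  by_cases hj : j ∈ s
  · have := Functor.isIso_map_biproduct_ι (DPerf.homology R j) b ⟨j, hj⟩
      fun k hk => hz k j fun h => hk (Subtype.ext h.symm)
    let a : (DPerf.homology R j).obj (b ⟨j, hj⟩) ≅ (DPerf.homology R j).obj (⨁ b) :=
      asIso ((DPerf.homology R j).map (biproduct.ι b ⟨j, hj⟩))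
    have ha : a.hom ≫ (DPerf.homology R j).map (biproduct.desc ψ) = (e j).hom ≫ f j := by
      rw [← hφ]
      exact ((DPerf.homology R j).map_comp _ _).symm.trans
        (congrArg _ (biproduct.ι_desc ψ ⟨j, hj⟩))
    rw [← Iso.eq_inv_comp] at ha
    refine ⟨Projective.of_iso ((e j).symm ≪≫ a) (hP'' j), ?_, fun h => ?_⟩
    · have := hf j
      rw [ha]
      infer_instance
    · have := hf' j h
      rw [ha]
      infer_instance
  · have hB : IsZero ((DPerf.homology R j).obj (⨁ b)) :=
      Functor.isZero_map_biproduct _ _ fun k => hz k j fun h => hj (h ▸ k.2)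
    have hX : IsZero ((DPerf.homology R j).obj X) := hs j hj
    exact ⟨hB.projective, ⟨fun _ _ _ => hX.eq_of_src _ _⟩,
      fun _ => ⟨fun _ _ _ => hB.eq_of_tgt _ _⟩⟩

/-- Surjectivity on cohomology breaks the long exact sequence of `B → X → Z` into `0 → H^j Z →
H^(j+1) B → H^(j+1) X → 0` with projective middle term, so `Z` satisfies the hypothesis for a bound
one smaller. -/
theorem DPerf.triangEnvelopeIter_of_hasProjectiveDimensionLT (hR : IsPseudoCoherent R R) (n : ℕ)
    (X : DPerf.{w} R)
    (hX : ∀ i, HasProjectiveDimensionLT ((DPerf.homology R i).obj X) (n + 1)) :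
    (ObjectProperty.singleton (DPerf.single (ModuleCat.of R R) 0)).triangEnvelopeIter n X := by
  induction n generalizing X with
  | zero =>
    obtain ⟨B, φ, hB, h⟩ := X.exists_epi_of_additiveClosure hR
    have : IsIso ((perfectComplexes.{w} R).ι.map φ) := by
      rw [isIso_iff]
      intro j
      obtain ⟨-, h₁, h₂⟩ := h j
      have := h₂ (projective_iff_hasProjectiveDimensionLT_one.2 (hX j))
      exact isIso_of_mono_of_epi ((DPerf.homology R j).map φ)
    have : IsIso φ := isIso_of_fully_faithful (perfectComplexes.{w} R).ι φ
    rw [ObjectProperty.triangEnvelopeIter_zero]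
    exact ObjectProperty.prop_of_iso _ (asIso φ) hB
  | succ n ih =>
    obtain ⟨B, φ, hB, h⟩ := X.exists_epi_of_additiveClosure hR
    obtain ⟨Z, g, k, hT⟩ := distinguished_cocone_triangle φ
    rw [ObjectProperty.triangEnvelopeIter_succ]
    refine ObjectProperty.le_retractClosure _ _ ⟨B, Z, φ, g, k, hT, hB, ih Z fun j => ?_⟩
    have hT' := (perfectComplexes.{w} R).ι.map_distinguished _ hT
    have hepi (j : ℤ) : Epi ((homologyFunctor (ModuleCat.{u} R) j).map
      ((perfectComplexes.{w} R).ι.mapTriangle.obj (Triangle.mk φ g k)).mor₁) := (h j).2.1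
    have h₀ := (HomologySequence.epi_homologyMap_mor₁_iff _ hT' j).1 (hepi j)
    have hmono := (HomologySequence.exact₃ _ hT' j (j + 1) rfl).mono_g h₀
    have hS : (ShortComplex.mk _ _ (HomologySequence.δ_comp _ hT' j (j + 1) rfl)).ShortExact :=
      { exact := HomologySequence.exact₁ _ hT' j (j + 1) rfl
        mono_f := hmono
        epi_g := hepi (j + 1) }
    have := (h (j + 1)).1
    exact hS.hasProjectiveDimensionLT_X₁ (n + 1)
      (hasProjectiveDimensionLT_of_ge ((DPerf.homology R (j + 1)).obj B) 1 (n + 1) (by lia))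
      (hX (j + 1))

theorem rouquierDimension_DPerf_lt_top (hR : IsPseudoCoherent R R) (n : ℕ)
    (h : ∀ M : ModuleCat.{u} R, Module.FinitePresentation R M → projectiveDimension M ≤ (n : WithBot ℕ∞)) :
    rouquierDimension (DPerf.{w} R) < ⊤ := by
  refine lt_of_le_of_lt (iInf₂_le n ⟨DPerf.single (ModuleCat.of R R) 0, ?_⟩) (ENat.natCast_lt_top n)
  rw [eq_top_iff]
  intro X _
  exact DPerf.triangEnvelopeIter_of_hasProjectiveDimensionLT hR n X fun i =>
    (projectiveDimension_le_iff _ _).1 (h _ (X.finitePresentation_homology hR i))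

end Generation

end

noncomputable section

/-! ### A ghost lemma for Ext classes -/

namespace DerivedCategory

section Factorization

variable {C : Type*} [Category* C] [Abelian C] [HasDerivedCategory.{w} C]

/-- Maps out of a K-projective complex come from chain maps, and a chain map to an object in degree
`i` only sees `K.X i`. -/
theorem eq_zero_of_isKProjective_of_isZero (K : CochainComplex C ℤ) [K.IsKProjective] {i : ℤ}
    (hK : IsZero (K.X i)) {V : C} (f : Q.obj K ⟶ (singleFunctor C i).obj V) : f = 0 := by
  let L := (HomologicalComplex.single C (ComplexShape.up ℤ) i).obj V
  let s : (singleFunctor C i).obj V ≅ Q.obj L := (singleFunctorIsoCompQ C i).app V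
  obtain ⟨g, hg⟩ := (CochainComplex.IsKProjective.Qh_map_bijective K
    ((HomotopyCategory.quotient _ _).obj L)).surjective
      ((quotientCompQhIso C).hom.app K ≫ f ≫ s.hom ≫ (quotientCompQhIso C).inv.app L)
  obtain ⟨φ, rfl⟩ := (HomotopyCategory.quotient _ _).map_surjective g
  have hφ : φ = 0 := by
    refine HomologicalComplex.Hom.ext (funext fun j => ?_)
    by_cases hj : j = i
    · subst hj
      exact hK.eq_of_src _ _
    · exact (HomologicalComplex.isZero_single_obj_X (ComplexShape.up ℤ) i V j hj).eq_of_tgt _ _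
  subst hφ
  rw [Functor.map_zero, Functor.map_zero] at hg
  have hg' := hg.symm
  rwa [Preadditive.IsIso.comp_left_eq_zero, ← Category.assoc,
    Preadditive.IsIso.comp_right_eq_zero, Preadditive.IsIso.comp_right_eq_zero] at hg'

theorem eq_zero_of_projective {P V : C} [Projective P] {p q : ℤ} (h : p ≠ q)
    (f : (singleFunctor C p).obj P ⟶ (singleFunctor C q).obj V) : f = 0 := by
  let K := (CochainComplex.singleFunctor C p).obj P
  have hX (j : ℤ) (hj : j ≠ p) : IsZero (K.X j) :=
    HomologicalComplex.isZero_single_obj_X (ComplexShape.up ℤ) p P j hj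
  have (j : ℤ) : Projective (K.X j) := by
    by_cases hj : j = p
    · subst hj
      exact Projective.of_iso
        (HomologicalComplex.singleObjXSelf (ComplexShape.up ℤ) j P).symm inferInstance
    · exact (hX j hj).projective
  have := CochainComplex.isKProjective_of_projective K p
  exact eq_zero_of_isKProjective_of_isZero K (hX q h.symm) f

/-- The distinguished triangle given by a short exact sequence placed in degree `p`. -/
theorem exists_single_triangle_distinguished {S : ShortComplex C} (hS : S.ShortExact) (p : ℤ) :
    ∃ δ : (singleFunctor C p).obj S.X₃ ⟶ ((singleFunctor C p).obj S.X₁)⟦(1 : ℤ)⟧,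
      Triangle.mk ((singleFunctor C p).map S.f) ((singleFunctor C p).map S.g) δ ∈
        distTriang (DerivedCategory.{w} C) :=
  ⟨_, triangleOfSES_distinguished
    (hS.map_of_exact (HomologicalComplex.single C (ComplexShape.up ℤ) p))⟩

/-- For `q < p` the map `e` dies on the projective cover of `U` in degree `p`, so it factors through
the connecting map to the syzygy of `U` in degree `p - 1`. Repeating this `k` times reaches degree
`r`. -/
theorem exists_factorization [EnoughProjectives C] {U V : C} {p q r : ℤ} (k : ℕ) (hr : r + k = p)
    (hq : q ≤ r) (e : (singleFunctor C p).obj U ⟶ (singleFunctor C q).obj V) :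
    ∃ (W : C) (α : (singleFunctor C p).obj U ⟶ (singleFunctor C r).obj W)
      (β : (singleFunctor C r).obj W ⟶ (singleFunctor C q).obj V), α ≫ β = e := by
  induction k generalizing p U with
  | zero =>
    obtain rfl : r = p := by simpa using hr
    exact ⟨U, 𝟙 _, e, Category.id_comp e⟩
  | succ k ih =>
    let π := Projective.π U
    let S := ShortComplex.mk (kernel.ι π) π (kernel.condition π)
    have hS : S.ShortExact :=
      { exact := ShortComplex.exact_kernel π
        mono_f := inferInstanceAs (Mono (kernel.ι π))
        epi_g := inferInstanceAs (Epi π) }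
    obtain ⟨δ, hδ⟩ := exists_single_triangle_distinguished hS p
    obtain ⟨e', he'⟩ : ∃ e' : ((singleFunctor C p).obj S.X₁)⟦(1 : ℤ)⟧ ⟶ (singleFunctor C q).obj V,
        e = δ ≫ e' :=
      Triangle.yoneda_exact₃ _ hδ e
        (eq_zero_of_projective (P := Projective.over U) (by push_cast at hr; lia) _)
    let σ : ((singleFunctor C p).obj S.X₁)⟦(1 : ℤ)⟧ ≅ (singleFunctor C (p - 1)).obj S.X₁ :=
      ((singleFunctors C).shiftIso 1 (p - 1) p (by lia)).app S.X₁
    obtain ⟨W, α, β, hαβ⟩ := ih (p := p - 1) (by push_cast at hr; lia) (σ.inv ≫ e')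
    refine ⟨W, δ ≫ σ.hom ≫ α, β, ?_⟩
    rw [Category.assoc, Category.assoc, hαβ, Iso.hom_inv_id_assoc, he']

/-- The objects `X` such that each map from `X` to an object in degree `p` is killed by each map
to an object in degree `q`, as soon as `q + c ≤ p`. -/
def killsExt (C : Type*) [Category* C] [Abelian C] [HasDerivedCategory.{w} C] (c : ℕ) :
    ObjectProperty (DerivedCategory.{w} C) := fun X =>
  ∀ ⦃p q : ℤ⦄, q + c ≤ p → ∀ ⦃U V : C⦄ (x : X ⟶ (singleFunctor C p).obj U)
    (e : (singleFunctor C p).obj U ⟶ (singleFunctor C q).obj V), x ≫ e = 0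

instance (c : ℕ) : (killsExt.{w} C c).IsStableUnderRetracts where
  of_retract := by
    intro X Y r hY p q h U V x e
    have := r.i ≫= hY h (r.r ≫ x) e
    rwa [Category.assoc, r.retract_assoc, comp_zero] at this

/-- Split `e` at degree `p - c₁`. The first factor kills `x` on `obj₁`, so the composite comes from
`obj₃`, where the second factor, still dropping at least `c₂` degrees, kills it. -/
theorem killsExt_of_distinguished [EnoughProjectives C] {c₁ c₂ : ℕ}
    (T : Triangle (DerivedCategory.{w} C)) (hT : T ∈ distTriang (DerivedCategory.{w} C))
    (h₁ : killsExt C c₁ T.obj₁) (h₃ : killsExt C c₂ T.obj₃) : killsExt C (c₁ + c₂) T.obj₂ := by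
  intro p q h U V x e
  obtain ⟨W, α, β, rfl⟩ := exists_factorization (r := p - c₁) c₁ (by lia) (by lia) e
  obtain ⟨y, hy⟩ := Triangle.yoneda_exact₂ T hT (x ≫ α) (by
    rw [← Category.assoc]
    exact h₁ (by lia) _ _)
  rw [← Category.assoc, hy, Category.assoc, h₃ (by push_cast at h; lia) y β, comp_zero]

/-- A nonzero composite would need `p ≤ b` and `a ≤ q`, so a degree drop of at most `b - a`. -/
theorem killsExt_Q_obj (K : CochainComplex C ℤ) [K.IsKProjective] (a b : ℤ) [K.IsStrictlyGE a]
    [K.IsStrictlyLE b] {c : ℕ} (h : b < a + c) : killsExt C c (Q.obj K) := by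
  intro p q hpq U V x e
  by_cases hp : b < p
  · rw [eq_zero_of_isKProjective_of_isZero K (K.isZero_of_isStrictlyLE b p hp) x, zero_comp]
  · exact eq_zero_of_isKProjective_of_isZero K (K.isZero_of_isStrictlyGE a q (by lia)) _

instance (c : ℕ) : (killsExt.{w} C c).ContainsZero where
  exists_zero := ⟨0, isZero_zero _, fun _ _ _ _ _ _ _ => (isZero_zero _).eq_of_src _ _⟩

instance (c : ℕ) : (killsExt.{w} C c).IsClosedUnderBinaryProducts where
  limitsOfShape_le := by
    rintro X ⟨p⟩
    refine ObjectProperty.prop_of_iso _ (IsLimit.conePointUniqueUpToIso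
      (BinaryBiproduct.isLimit (p.diag.obj (.mk .left)) (p.diag.obj (.mk .right)))
      ((IsLimit.postcomposeHomEquiv (diagramIsoPair p.diag) _).2 p.isLimit)) ?_
    intro i j h U V x e
    refine biprod.hom_ext' (X := p.diag.obj (.mk .left)) (Y := p.diag.obj (.mk .right)) _ _ ?_ ?_
    · exact ((Category.assoc _ _ _).symm.trans (p.prop_diag_obj (.mk .left) h _ e)).trans
        comp_zero.symm
    · exact ((Category.assoc _ _ _).symm.trans (p.prop_diag_obj (.mk .right) h _ e)).trans
        comp_zero.symm

end Factorization

end DerivedCategory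

/-! ### Finite Rouquier dimension bounds projective dimensions -/

section RouquierDimension

open DerivedCategory

variable {R : Type u} [Ring R] [HasDerivedCategory.{w} (ModuleCat.{u} R)]

variable (R) in
/-- The perfect complexes satisfying `DerivedCategory.killsExt`. -/
def DPerf.killsExt (c : ℕ) : ObjectProperty (DPerf.{w} R) :=
  (DerivedCategory.killsExt (ModuleCat.{u} R) c).inverseImage (perfectComplexes.{w} R).ι

instance (c : ℕ) : (DPerf.killsExt.{w} R c).IsStableUnderRetracts where
  of_retract r h := (DerivedCategory.killsExt (ModuleCat.{u} R) c).prop_of_retract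
    (r.map (perfectComplexes.{w} R).ι) h

instance (c : ℕ) : (DPerf.killsExt.{w} R c).ContainsZero :=
  inferInstanceAs (ObjectProperty.inverseImage _ _).ContainsZero

instance (c : ℕ) : (DPerf.killsExt.{w} R c).IsClosedUnderBinaryProducts :=
  inferInstanceAs (ObjectProperty.IsClosedUnderLimitsOfShape (ObjectProperty.inverseImage _ _) _)

theorem DPerf.exists_shiftClosure_singleton_le_killsExt (G : DPerf.{w} R) :
    ∃ c : ℕ, (ObjectProperty.singleton G).shiftClosure ℤ ≤ DPerf.killsExt R c := by
  obtain ⟨K, hK, ⟨e⟩⟩ := G.property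
  obtain ⟨⟨a, _⟩, ⟨b, _⟩, -⟩ := id hK
  -- The width of the amplitude is unchanged by shifts, so one constant serves them all.
  refine ⟨(b - a + 1).toNat, ?_⟩
  rintro X ⟨_, n, e', h⟩
  obtain rfl := (ObjectProperty.singleton_iff _ _).1 h
  have e₁ : X.obj ≅ Q.obj (K⟦n⟧) := (perfectComplexes.{w} R).ι.mapIso e' ≪≫
    ((perfectComplexes.{w} R).ι.commShiftIso n).app _ ≪≫ (shiftFunctor _ n).mapIso e ≪≫
      (Q.commShiftIso n).symm.app K
  have := (hK.shift n).isKProjective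
  have := K.isStrictlyGE_shift a n (a - n) (by lia)
  have := K.isStrictlyLE_shift b n (b - n) (by lia)
  exact ObjectProperty.prop_of_iso (DerivedCategory.killsExt (ModuleCat.{u} R) _) e₁.symm
    (killsExt_Q_obj (K⟦n⟧) (a - n) (b - n) (by lia))

theorem DPerf.triangEnvelopeIter_le_killsExt (P : ObjectProperty (DPerf.{w} R)) (c : ℕ)
    (hP : P.shiftClosure ℤ ≤ DPerf.killsExt R c) (d : ℕ) :
    P.triangEnvelopeIter d ≤ DPerf.killsExt R (c * (d + 1)) := by
  have h : (P.shiftClosure ℤ).binaryProductsClosure.retractClosure ≤ DPerf.killsExt R c := by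
    rwa [ObjectProperty.retractClosure_le_iff, ObjectProperty.binaryProductsClosure_le_iff]
  induction d with
  | zero => simpa [ObjectProperty.triangEnvelopeIter_zero] using h
  | succ d ih =>
    rw [ObjectProperty.triangEnvelopeIter_succ, ObjectProperty.retractClosure_le_iff]
    rintro X ⟨Y, Z, f, g, k, hT, hY, hZ⟩
    have := killsExt_of_distinguished _ ((perfectComplexes.{w} R).ι.map_distinguished _ hT)
      (h _ hY) (ih _ hZ)
    rwa [show c * (d + 1 + 1) = c + c * (d + 1) by ring]

/-- A finitely presented module is an extension of a complex in very negative degrees by a perfect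
complex. -/
theorem extensionProduct_perfectComplexes_single (hR : IsPseudoCoherent R R) (N : ℕ)
    (M : ModuleCat.{u} R) [Module.FinitePresentation R M] (p : ℤ) :
    (perfectComplexes.{w} R).extensionProduct (fun Z => Z.IsLE (p - N))
      ((singleFunctor (ModuleCat.{u} R) p).obj M) := by
  induction N generalizing M p with
  | zero =>
    refine ObjectProperty.le_extensionProduct_right _ _ ?_
    simp only [Nat.cast_zero, sub_zero]
    infer_instance
  | succ N ih =>
    -- The kernel of a finite free cover, moved to degree `p - 1`, is handled by induction; the free
    -- module and the perfect part of the kernel merge into one perfect complex.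
    obtain ⟨n, f, hf⟩ := Module.Finite.exists_fin' R M
    have := hR.finitePresentation_ker f
    have hS := LinearMap.shortExact_shortComplexKer hf
    obtain ⟨δ, hδ⟩ := exists_single_triangle_distinguished hS p
    have e : (singleFunctor (ModuleCat.{u} R) (p - 1)).obj (ModuleCat.of R (LinearMap.ker f)) ≅
        ((singleFunctor (ModuleCat.{u} R) p).obj (ModuleCat.of R (LinearMap.ker f)))⟦(1 : ℤ)⟧ :=
      ((singleFunctors (ModuleCat.{u} R)).shiftIso 1 (p - 1) p (by lia)).symm.app _
    have h₁ := ObjectProperty.prop_of_iso _ e (ih (ModuleCat.of R (LinearMap.ker f)) (p - 1))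
    have h₂ : (perfectComplexes.{w} R).extensionProduct ((perfectComplexes.{w} R).extensionProduct
        (fun Z => Z.IsLE (p - 1 - N))) ((singleFunctor (ModuleCat.{u} R) p).obj M) :=
      ⟨_, _, _, _, _, rot_of_distTriang _ hδ,
        perfectComplexes_single (ModuleCat.of R (Fin n → R)) p, h₁⟩
    rw [← ObjectProperty.extensionProduct_assoc] at h₂
    rw [show p - (N + 1 : ℕ) = p - 1 - N by push_cast; lia]
    exact ObjectProperty.monotone_extensionProduct_left _
      (ObjectProperty.extensionProduct_le_of_isTriangulatedClosed₂ le_rfl le_rfl) _ h₂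

/-- If all the perfect complexes satisfy `DPerf.killsExt`, then the projective dimensions of
finitely presented modules are bounded. -/
theorem projectiveDimension_le_of_killsExt (hR : IsPseudoCoherent R R) (c : ℕ)
    (h : DPerf.killsExt.{w} R c = ⊤) (M : ModuleCat.{u} R) [Module.FinitePresentation R M] :
    projectiveDimension M ≤ (c : WithBot ℕ∞) := by
  have := HasExt.standard (ModuleCat.{u} R)
  rw [projectiveDimension_le_iff]
  refine HasProjectiveDimensionLT.mk fun i hi V e => ?_
  -- Depth `i + 1` puts `Z` strictly below degree `-i`, where `V` sits. So a class vanishing on `X`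
  -- factors through `Z` and is zero.
  obtain ⟨X, Z, f, g, k, hT, hX, hZ⟩ :=
    extensionProduct_perfectComplexes_single.{w} hR (i + 1) M 0
  let σ : ((singleFunctor (ModuleCat.{u} R) 0).obj V)⟦(i : ℤ)⟧ ≅
      (singleFunctor (ModuleCat.{u} R) (-i)).obj V :=
    ((singleFunctors (ModuleCat.{u} R)).shiftIso (i : ℤ) (-i) 0 (by lia)).app V
  have hk : DPerf.killsExt R c ⟨X, hX⟩ := by
    rw [h]
    trivial
  have hf : f ≫ e.hom ≫ σ.hom = 0 := hk (p := 0) (q := -i) (by lia) f (e.hom ≫ σ.hom)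
  obtain ⟨z, hz⟩ : ∃ z : Z ⟶ (singleFunctor (ModuleCat.{u} R) (-i)).obj V,
      e.hom ≫ σ.hom = g ≫ z := Triangle.yoneda_exact₂ _ hT _ hf
  have hz₀ : z = 0 := TStructure.t.zero_of_isLE_of_isGE z _ (-i) (by push_cast; lia) hZ
    inferInstance
  rw [hz₀, comp_zero, Preadditive.IsIso.comp_right_eq_zero] at hz
  exact Abelian.Ext.ext (hz.trans (Abelian.Ext.zero_hom ..).symm)

theorem exists_projectiveDimension_le_of_rouquierDimension_DPerf_lt_top
    (hR : IsPseudoCoherent R R) (h : rouquierDimension (DPerf.{w} R) < ⊤) :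
    ∃ n : ℕ, ∀ M : ModuleCat.{u} R, Module.FinitePresentation R M →
      projectiveDimension M ≤ (n : WithBot ℕ∞) := by
  simp only [rouquierDimension, iInf_lt_iff] at h
  obtain ⟨d, ⟨G, hG⟩, -⟩ := h
  obtain ⟨c, hc⟩ := G.exists_shiftClosure_singleton_le_killsExt
  refine ⟨c * (d + 1), fun M hM => projectiveDimension_le_of_killsExt hR _ ?_ M⟩
  rw [eq_top_iff, ← hG]
  exact DPerf.triangEnvelopeIter_le_killsExt _ c hc d

end RouquierDimension

end

theorem mainTheorem3 (A : Type u) [Ring A]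
    [HasDerivedCategory.{w} (ModuleCat.{u} Aᵐᵒᵖ)] (hA : IsRightCoherent A) :
    List.TFAE [
      weakGlobalDimension A < ⊤,
      ∃ n : ℕ, ∀ M : ModuleCat.{u} Aᵐᵒᵖ, Module.FinitePresentation Aᵐᵒᵖ M →
        projectiveDimension M ≤ (n : WithBot ℕ∞),
      rouquierDimension (DPerf.{w} Aᵐᵒᵖ) < ⊤] := by
  have hR := hA.isPseudoCoherent
  tfae_have 1 ↔ 2 := weakGlobalDimension_lt_top_iff_projectiveDimension_le hA
  tfae_have 2 → 3 := fun ⟨n, h⟩ => rouquierDimension_DPerf_lt_top hR n h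
  tfae_have 3 → 2 := exists_projectiveDimension_le_of_rouquierDimension_DPerf_lt_top hR
  tfae_finish
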